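/- Consider the square lattice $\mathbb{Z}^2$ with a spin-$\tfrac12$ at each bond (edge). Let $\mathfrak{A}$ be the quasi-local $C^*$-algebra, i.e. the norm closure of the union of the matrix algebras $\bigotimes_{b\in\Lambda}M_2(\mathbb{C})$ over finite sets $\Lambda$ of bonds, and let $\tau_x$, $x\in\mathbb{Z}^2$, be the translations of $\mathfrak{A}$. For a point $s$ put $A_s=\prod_{j}\sigma^x_j$ over the four bonds $j$ ending at $s$, and for a plaquette $p$ put $B_p=\prod_j\sigma^z_j$ over the four bonds $j$ of $p$. There is exactly one state $\omega_0$ on $\mathfrak{A}$ with $\omega_0(A_s)=\omega_0(B_p)=1$ for all $s$ and $p$ (the frustration-free ground state of the toric code). Let $\pi_0$ be its GNS representation, on the Hilbert space $\mathcal{H}_0$. Let $k\in\{X,Y,Z\}$ and let $\gamma$ be a path of type $k$ extending to infinity (i.e. eventually leaving every finite set): for $k=Z$ a path on the lattice; for $k=X$ a path on the dual lattice, whose vertices are the plaquettes; for $k=Y$ a ribbon, i.e. a sequence of pairs (plaquette, one of its corners), where in each step either the corner moves to a neighbouring point or the plaquette moves to a neighbouring plaquette. Let $\Gamma_n$ be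 the string operator of the first $n$ steps of $\gamma$: for $k=Z$ the product of $\sigma^z$ over the bonds traversed, for $k=X$ the product of $\sigma^x$ over the bonds crossed, and for $k=Y$ the product of $\sigma^x$ over the bonds crossed by the plaquette times the product of $\sigma^z$ over the bonds traversed by the corner (in all cases with one factor per step). Then there is an automorphism $\rho^k$ of $\mathfrak{A}$ with $\rho^k(A)=\lim_{n\to\infty}\Gamma_nA\Gamma_n^*$ in norm for all $A\in\mathfrak{A}$, and the representation $\pi_0\circ\rho^k$ is covariant with respect to translations: there is a group homomorphism $W$ from $\mathbb{Z}^2$ to the unitary group of $\mathcal{H}_0$ such that $$\pi_0\bigl(\rho^k(\tau_x(A))\bigr)=W(x)\,\pi_0\bigl(\rho^k(A)\bigr)\,W(x)^*\qquad\text{for all }x\in\mathbb{Z}^2,\ A\in\mathfrak{A}.$$ -/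

import Mathlib

open Filter Topology
open scoped ComplexOrder

noncomputable section

namespace ToricCode

/-! ### The lattice: points, bonds, stars, plaquettes -/

/-- Points of the square lattice. -/
abbrev Point : Type := ℤ × ℤ

/-- A plaquette (unit square) is labelled by its lower left corner. -/
abbrev Plaquette : Type := ℤ × ℤ

/-- The two directions of bonds. -/
inductive Direction : Type
  | hor
  | ver
  deriving DecidableEq

/-- `(v, hor)` is the bond from `v` to `v + (1, 0)`; `(v, ver)` is the bond from `v` to
`v + (0, 1)`. -/
abbrev Bond : Type := (ℤ × ℤ) × Direction

/-- The unit vector in horizontal direction. -/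
def e₁ : ℤ × ℤ := (1, 0)

/-- The unit vector in vertical direction. -/
def e₂ : ℤ × ℤ := (0, 1)

/-- The four bonds that have the point `s` as an endpoint. -/
def starBonds (s : Point) : List Bond :=
  [(s, .hor), (s, .ver), (s - e₁, .hor), (s - e₂, .ver)]

/-- The four bonds enclosing the plaquette `p`. -/
def plaqBonds (p : Plaquette) : List Bond :=
  [(p, .hor), (p, .ver), (p + e₂, .hor), (p + e₁, .ver)]

/-- The four corners of the plaquette `p`. -/
def corners (p : Plaquette) : List Point :=
  [p, p + e₁, p + e₂, p + e₁ + e₂]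

/-- `b` is the bond between the (distinct, neighbouring) points `v` and `w`. -/
def Joins (b : Bond) (v w : Point) : Prop :=
  v ≠ w ∧ b ∈ starBonds v ∧ b ∈ starBonds w

/-- `b` is the common bond of the (distinct, neighbouring) plaquettes `p` and `q`, i.e. the bond
crossed by the dual-lattice bond between `p` and `q`. -/
def Separates (b : Bond) (p q : Plaquette) : Prop :=
  p ≠ q ∧ b ∈ plaqBonds p ∧ b ∈ plaqBonds q

/-- Translation of bonds by `x`. -/
def shiftBond (x : ℤ × ℤ) : Bond ≃ Bond :=
  (Equiv.addRight x).prodCongr (Equiv.refl Direction)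

/-! ### The quasi-local algebra

The algebra is realised on the infinite tensor product of the spaces `ℂ²` (one for each bond) along
the reference vector "all spins up", i.e. on `ℓ²` of the set of those spin configurations that
differ from "all spins up" at only finitely many bonds. The Pauli matrices `σˣ`, `σᶻ` at a bond `b`
generate a copy of `M₂(ℂ)` there, and the copies at distinct bonds commute, so the `*`-algebra that
they generate is the union of the matrix algebras `⨂_{b ∈ Λ} M₂(ℂ)` over the finite sets `Λ` of
bonds. Its norm closure is the quasi-local algebra. -/

/-- Spin configurations (`0` is up, `1` is down) with finitely many spins down. -/
abbrev Config : Type := Bond →₀ ZMod 2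

/-- The Hilbert space `ℓ²(Config)`. -/
abbrev SpinSpace : Type := lp (fun _ : Config => ℂ) 2

lemma memℓp_monomial (e : Config ≃ Config) (u : Config → ℂ) (hu : ∀ c, ‖u c‖ = 1)
    (ψ : SpinSpace) : Memℓp (fun c => u c * ψ (e c)) 2 := by
  have h := (lp.memℓp ψ).summable (by norm_num)
  refine memℓp_gen ?_
  simpa [hu, Function.comp_def] using (e.summable_iff.mpr h)

/-- The unitary operator `(T ψ)(c) = u c * ψ (e c)`, for a permutation `e` of the configurations and
phases `u c`. -/
def monomial (e : Config ≃ Config) (u : Config → ℂ) (hu : ∀ c, ‖u c‖ = 1) :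
    SpinSpace ≃ₗᵢ[ℂ] SpinSpace where
  toFun ψ := ⟨fun c => u c * ψ (e c), memℓp_monomial e u hu ψ⟩
  invFun ψ := ⟨fun c => (u (e.symm c))⁻¹ * ψ (e.symm c),
    memℓp_monomial e.symm (fun c => (u (e.symm c))⁻¹) (by simp [hu]) ψ⟩
  map_add' ψ φ := by
    ext c
    exact mul_add _ _ _
  map_smul' a ψ := by
    ext c
    exact mul_left_comm _ _ _
  left_inv ψ := by
    ext c
    have h : u (e.symm c) ≠ 0 := fun h => by simpa [h] using hu (e.symm c)
    simp [inv_mul_cancel_left₀ h]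
  right_inv ψ := by
    ext c
    have h : u c ≠ 0 := fun h => by simpa [h] using hu c
    simp [mul_inv_cancel_left₀ h]
  norm_map' ψ := by
    have h2 : 0 < (2 : ENNReal).toReal := by norm_num
    rw [lp.norm_eq_tsum_rpow h2, lp.norm_eq_tsum_rpow h2]
    congr 1
    simpa [hu] using e.tsum_eq (fun c => ‖ψ c‖ ^ (2 : ENNReal).toReal)

/-- The Pauli matrix `σˣ` at the bond `b`: it flips the spin at `b`. -/
def pauliX (b : Bond) : SpinSpace →L[ℂ] SpinSpace :=
  (monomial (Equiv.addRight (Finsupp.single b 1)) (fun _ => 1) (by simp)).toContinuousLinearEquiv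

/-- The Pauli matrix `σᶻ` at the bond `b`: it is `1` on "up" and `-1` on "down". -/
def pauliZ (b : Bond) : SpinSpace →L[ℂ] SpinSpace :=
  (monomial (Equiv.refl Config) (fun c => (-1) ^ (c b).val) (by simp)).toContinuousLinearEquiv

/-- The unitary operator that translates spin configurations by `x`. -/
def translateOp (x : ℤ × ℤ) : SpinSpace ≃ₗᵢ[ℂ] SpinSpace :=
  monomial (Finsupp.domCongr (shiftBond x)).symm.toEquiv (fun _ => 1) (by simp)

/-- The `*`-algebra of local observables. -/
def localAlgebra : StarSubalgebra ℂ (SpinSpace →L[ℂ] SpinSpace) :=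
  StarAlgebra.adjoin ℂ (Set.range pauliX ∪ Set.range pauliZ)

/-- The quasi-local algebra, a `C*`-algebra of operators on `SpinSpace`. -/
def quasiLocal : StarSubalgebra ℂ (SpinSpace →L[ℂ] SpinSpace) :=
  localAlgebra.topologicalClosure

/-- The quasi-local `C*`-algebra as a type. -/
abbrev QuasiLocal : Type := quasiLocal

instance quasiLocal_isClosed :
    IsClosed (quasiLocal : Set (SpinSpace →L[ℂ] SpinSpace)) :=
  localAlgebra.isClosed_topologicalClosure

/-- The order of the `C*`-algebra: `a ≤ b` if and only if `b - a` is positive. -/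
instance : PartialOrder QuasiLocal := CStarAlgebra.spectralOrder QuasiLocal

instance : StarOrderedRing QuasiLocal := CStarAlgebra.spectralOrderedRing QuasiLocal

/-- `σˣ` at the bond `b`, as an element of the quasi-local algebra. -/
def σx (b : Bond) : QuasiLocal :=
  ⟨pauliX b, localAlgebra.le_topologicalClosure
    (StarAlgebra.subset_adjoin ℂ _ (Or.inl ⟨b, rfl⟩))⟩

/-- `σᶻ` at the bond `b`, as an element of the quasi-local algebra. -/
def σz (b : Bond) : QuasiLocal :=
  ⟨pauliZ b, localAlgebra.le_topologicalClosure
    (StarAlgebra.subset_adjoin ℂ _ (Or.inr ⟨b, rfl⟩))⟩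

/-! ### Translations -/

lemma monomial_apply (e : Config ≃ Config) (u : Config → ℂ) (hu : ∀ c, ‖u c‖ = 1)
    (ψ : SpinSpace) (c : Config) : monomial e u hu ψ c = u c * ψ (e c) := rfl

lemma monomial_symm_apply (e : Config ≃ Config) (u : Config → ℂ) (hu : ∀ c, ‖u c‖ = 1)
    (ψ : SpinSpace) (c : Config) :
    (monomial e u hu).symm ψ c = (u (e.symm c))⁻¹ * ψ (e.symm c) := rfl

lemma pauliX_apply (b : Bond) (ψ : SpinSpace) (c : Config) :
    pauliX b ψ c = ψ (c + Finsupp.single b 1) := one_mul _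

lemma pauliZ_apply (b : Bond) (ψ : SpinSpace) (c : Config) :
    pauliZ b ψ c = (-1) ^ (c b).val * ψ c := rfl

lemma conj_pauliX (x : ℤ × ℤ) (b : Bond) :
    (translateOp x).conjStarAlgEquiv (pauliX b) = pauliX (shiftBond x b) := by
  ext ψ c
  rw [LinearIsometryEquiv.conjStarAlgEquiv_apply_apply, pauliX_apply, translateOp, monomial_apply,
    pauliX_apply, monomial_symm_apply]
  have h : Finsupp.equivMapDomain (shiftBond x)
      (Finsupp.equivMapDomain (shiftBond x).symm c + Finsupp.single b 1) =
        c + Finsupp.single (shiftBond x b) 1 := by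
    classical
    ext d
    simp [Finsupp.single_apply, Equiv.eq_symm_apply]
  simp [Finsupp.domCongr, h]

lemma conj_pauliZ (x : ℤ × ℤ) (b : Bond) :
    (translateOp x).conjStarAlgEquiv (pauliZ b) = pauliZ (shiftBond x b) := by
  ext ψ c
  rw [LinearIsometryEquiv.conjStarAlgEquiv_apply_apply, pauliZ_apply, translateOp, monomial_apply,
    pauliZ_apply, monomial_symm_apply]
  have h : Finsupp.equivMapDomain (shiftBond x)
      (Finsupp.equivMapDomain (shiftBond x).symm c) = c := by
    ext d
    simp
  simp [Finsupp.domCongr, h]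

lemma conj_mem (x : ℤ × ℤ) {a : SpinSpace →L[ℂ] SpinSpace} (ha : a ∈ quasiLocal) :
    (translateOp x).conjStarAlgEquiv a ∈ quasiLocal := by
  have hcont : Continuous (translateOp x).conjStarAlgEquiv := by
    exact (AddMonoidHomClass.isometry_of_norm _ fun a =>
      NonUnitalStarAlgHom.norm_map _ (EquivLike.injective _) a).continuous
  have hloc : ∀ a ∈ localAlgebra, (translateOp x).conjStarAlgEquiv a ∈ localAlgebra := by
    intro a ha
    induction ha using StarAlgebra.adjoin_induction with
    | mem a h =>
      rcases h with ⟨b, rfl⟩ | ⟨b, rfl⟩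
      · rw [conj_pauliX]
        exact StarAlgebra.subset_adjoin ℂ _ (Or.inl ⟨_, rfl⟩)
      · rw [conj_pauliZ]
        exact StarAlgebra.subset_adjoin ℂ _ (Or.inr ⟨_, rfl⟩)
    | algebraMap r =>
      rw [AlgHomClass.commutes]
      exact algebraMap_mem _ r
    | add a b _ _ ha hb => rw [map_add]; exact add_mem ha hb
    | mul a b _ _ ha hb => rw [map_mul]; exact mul_mem ha hb
    | star a _ ha => rw [map_star]; exact star_mem ha
  exact map_mem_closure hcont ha hloc

/-- The translation `τ_x` of the quasi-local algebra. -/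
def τ (x : ℤ × ℤ) : QuasiLocal →⋆ₐ[ℂ] QuasiLocal :=
  StarAlgHom.codRestrict
    ((StarAlgHomClass.toStarAlgHom (translateOp x).conjStarAlgEquiv).comp quasiLocal.subtype)
    quasiLocal (fun a => conj_mem x a.2)

/-- Translations act on the Pauli matrices by translating the bond. -/
lemma τ_σx (x : ℤ × ℤ) (b : Bond) : τ x (σx b) = σx (shiftBond x b) :=
  Subtype.ext (conj_pauliX x b)

lemma τ_σz (x : ℤ × ℤ) (b : Bond) : τ x (σz b) = σz (shiftBond x b) :=
  Subtype.ext (conj_pauliZ x b)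

/-! ### The ground state -/

/-- The star operator `A_s = ⨂_{j ∈ star(s)} σˣ_j`. -/
def starOp (s : Point) : QuasiLocal := ((starBonds s).map σx).prod

/-- The plaquette operator `B_p = ⨂_{j ∈ plaq(p)} σᶻ_j`. -/
def plaqOp (p : Plaquette) : QuasiLocal := ((plaqBonds p).map σz).prod

/-- `ω` is a state with `ω(A_s) = ω(B_p) = 1` for all stars `s` and plaquettes `p`. -/
def IsFrustrationFreeGroundState (ω : QuasiLocal →ₚ[ℂ] ℂ) : Prop :=
  ω 1 = 1 ∧ (∀ s, ω (starOp s) = 1) ∧ (∀ p, ω (plaqOp p) = 1)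

/-! ### Strings extending to infinity -/

/-- A path of bonds on the lattice, starting at a point and extending to infinity (it eventually
leaves every finite set). -/
structure LatticePath where
  point : ℕ → Point
  bond : ℕ → Bond
  joins : ∀ n, Joins (bond n) (point n) (point (n + 1))
  toInfinity : Tendsto point atTop cofinite

/-- A path on the dual lattice, starting at a plaquette and extending to infinity; `bond n` is the
bond crossed in the `n`-th step. -/
structure DualPath where
  plaquette : ℕ → Plaquette
  bond : ℕ → Bond
  separates : ∀ n, Separates (bond n) (plaquette n) (plaquette (n + 1))
  toInfinity : Tendsto plaquette atTop cofinite

/-- A ribbon, starting at a combined site and extending to infinity. A combined site is a plaquette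
with one of its corners. In each step either the corner moves along a bond of the lattice
(`onLattice n = true`) or the plaquette moves along a bond of the dual lattice
(`onLattice n = false`); `bond n` is the bond traversed, respectively crossed. -/
structure Ribbon where
  point : ℕ → Point
  plaquette : ℕ → Plaquette
  bond : ℕ → Bond
  onLattice : ℕ → Bool
  combined : ∀ n, point n ∈ corners (plaquette n)
  latticeStep : ∀ n, onLattice n = true →
    Joins (bond n) (point n) (point (n + 1)) ∧ plaquette (n + 1) = plaquette n
  dualStep : ∀ n, onLattice n = false →
    Separates (bond n) (plaquette n) (plaquette (n + 1)) ∧ point (n + 1) = point n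
  toInfinity : Tendsto (fun n => (point n, plaquette n)) atTop cofinite

/-- A path of type `X`, `Y` or `Z` extending to infinity. -/
inductive InfiniteString : Type
  | X (γ : DualPath)
  | Y (γ : Ribbon)
  | Z (γ : LatticePath)

/-- The string operator of the first `n` bonds of the string: a product of `σˣ` over the bonds
crossed for type `X`, of `σᶻ` over the bonds traversed for type `Z`, and for type `Y` the product of
the type-`X` string operator of the dual path of the ribbon and the type-`Z` string operator of the
lattice path of the ribbon. -/
def InfiniteString.op : InfiniteString → ℕ → QuasiLocal
  | .X γ, n => ((List.range n).map fun i => σx (γ.bond i)).prod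
  | .Z γ, n => ((List.range n).map fun i => σz (γ.bond i)).prod
  | .Y γ, n =>
      ((List.range n).map fun i => if γ.onLattice i then 1 else σx (γ.bond i)).prod *
      ((List.range n).map fun i => if γ.onLattice i then σz (γ.bond i) else 1).prod

/-- `ρ` is the string automorphism defined by `γ`: it is the pointwise norm limit of
`Ad Γ_n`, where `Γ_n` is the string operator of the first `n` bonds of `γ`. -/
def IsStringAutomorphism (γ : InfiniteString) (ρ : QuasiLocal ≃⋆ₐ[ℂ] QuasiLocal) : Prop :=
  ∀ A, Tendsto (fun n => γ.op n * A * star (γ.op n)) atTop (𝓝 (ρ A))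

end ToricCode

end

open Filter Topology
open scoped ComplexOrder

noncomputable section

namespace ToricCode

/-! ### Products of Pauli matrices -/

/-! The products of Pauli matrices `X a * Z b`, indexed by finite sets of bonds, span a dense
subspace and commute up to signs. The proof rests on one rigidity principle, `HasCharges.ext`.
Suppose multiplying the argument of a continuous functional by a star or plaquette operator, on
either side, only produces a prescribed sign. Then its value at `X a * Z b` vanishes if that product
anticommutes with some star or plaquette operator. Otherwise `b` is a finite cycle and `a` a finite
dual cycle. Since the plane has trivial first homology mod 2 (`mem_boundaries`, `mem_coboundaries`),
the product is then one of plaquette and star operators. The signs and the value at `1` therefore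
determine the functional.

By Cauchy–Schwarz, a frustration-free state has all signs `+1`, hence it is unique. It exists as an
ultrafilter limit of vector states obtained by applying the factors `1 + A_s` to the all-up vector.

Conjugation by a finite string multiplies each `X a * Z b` by a sign, which stabilises because the
string leaves the finite supports. The conjugations are isometric, so the limit exists everywhere,
and it is an involution. It flips only the star at the initial point (types Y, Z) and the plaquette
at the initial face (types X, Y). So in `π₀ ∘ ρ` the GNS vector is a cyclic joint eigenvector with
at most one charge and one flux.

For each unit translation, a one-step string `F` moves charge and flux by that vector. Rigidity
identifies the translated vector state with the original one, so `π(A)Ψ ↦ π(τ A · F)Ψ` defines a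
unitary implementing the translation. The two unitaries commute because the two orders of transport
differ only by a plaquette and a star that act trivially (`IsCharged.transport_comm`). They thus
generate a genuine representation of `ℤ²`, not just a projective one. -/

/-- The character `z ↦ (-1) ^ z` of `ℤ/2`. -/
def sgn (z : ZMod 2) : ℂ := (-1) ^ z.val

lemma zmod_two_cases (z : ZMod 2) : z = 0 ∨ z = 1 := by
  revert z
  decide

@[simp] lemma sgn_zero : sgn 0 = 1 := by simp [sgn]

@[simp] lemma sgn_one : sgn 1 = -1 := by simp [sgn, ZMod.val_one]

lemma sgn_add (x y : ZMod 2) : sgn (x + y) = sgn x * sgn y := by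
  rcases zmod_two_cases x with rfl | rfl <;> rcases zmod_two_cases y with rfl | rfl <;>
    simp [show (1 + 1 : ZMod 2) = 0 from rfl]

lemma sgn_mul_self (x : ZMod 2) : sgn x * sgn x = 1 := by
  rcases zmod_two_cases x with rfl | rfl <;> simp

lemma sgn_ne_zero (x : ZMod 2) : sgn x ≠ 0 := by
  rcases zmod_two_cases x with rfl | rfl <;> simp

@[simp] lemma norm_sgn (x : ZMod 2) : ‖sgn x‖ = 1 := by
  rcases zmod_two_cases x with rfl | rfl <;> simp

@[simp] lemma star_sgn (x : ZMod 2) : star (sgn x) = sgn x := by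
  rcases zmod_two_cases x with rfl | rfl <;> simp

/-- The pairing `∑ b, a b * f b` of two configurations. -/
def pair (a f : Config) : ZMod 2 := a.sum fun i z => z * f i

@[simp] lemma pair_zero_left (f : Config) : pair 0 f = 0 := Finsupp.sum_zero_index

lemma pair_add_left (a b f : Config) : pair (a + b) f = pair a f + pair b f :=
  Finsupp.sum_add_index' (by simp) (by simp [add_mul])

lemma pair_add_right (a f g : Config) : pair a (f + g) = pair a f + pair a g := by
  simp [pair, mul_add, Finsupp.sum_add]

@[simp] lemma pair_zero_right (a : Config) : pair a 0 = 0 := by simp [pair]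

@[simp] lemma pair_single_left (b : Bond) (z : ZMod 2) (f : Config) :
    pair (Finsupp.single b z) f = z * f b := by simp [pair]

lemma pair_comm (a f : Config) : pair a f = pair f a := by
  induction a using Finsupp.induction_linear with
  | zero => simp
  | add a b ha hb => rw [pair_add_left, pair_add_right, ha, hb]
  | single b z =>
    rw [pair_single_left]
    simp only [pair, Finsupp.sum]
    rw [Finset.sum_eq_single b]
    · simp [mul_comm]
    · intro c _ hc
      simp [hc.symm]
    · intro h
      simp [Finsupp.notMem_support_iff.mp h]

@[simp] lemma pair_single_right (b : Bond) (z : ZMod 2) (f : Config) :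
    pair f (Finsupp.single b z) = z * f b := by rw [pair_comm, pair_single_left]

lemma config_add_self (a : Config) : a + a = 0 := by
  ext b
  exact CharTwo.add_self_eq_zero _

/-- The product of `σˣ` over the support of `a`, as an operator. -/
def opX (a : Config) : SpinSpace →L[ℂ] SpinSpace :=
  (monomial (Equiv.addRight a) (fun _ => 1) (by simp)).toContinuousLinearEquiv

/-- The product of `σᶻ` over the support of `b`, as an operator. -/
def opZ (b : Config) : SpinSpace →L[ℂ] SpinSpace :=
  (monomial (Equiv.refl Config) (fun c => sgn (pair b c)) (by simp)).toContinuousLinearEquiv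

lemma opX_apply (a : Config) (ψ : SpinSpace) (c : Config) : opX a ψ c = ψ (c + a) := one_mul _

lemma opZ_apply (b : Config) (ψ : SpinSpace) (c : Config) :
    opZ b ψ c = sgn (pair b c) * ψ c := rfl

lemma opX_zero : opX 0 = 1 := by
  ext ψ c
  simp [opX_apply]

lemma opZ_zero : opZ 0 = 1 := by
  ext ψ c
  simp [opZ_apply]

lemma opX_add (a b : Config) : opX (a + b) = opX a * opX b := by
  ext ψ c
  simp [opX_apply, add_assoc]

lemma opZ_add (a b : Config) : opZ (a + b) = opZ a * opZ b := by
  ext ψ c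
  simp [opZ_apply, pair_add_left, sgn_add, mul_assoc]

lemma opX_mul_opZ (a b : Config) : opX a * opZ b = sgn (pair b a) • (opZ b * opX a) := by
  ext ψ c
  have h : ∀ φ : SpinSpace, (sgn (pair b a) • φ) c = sgn (pair b a) * φ c := fun φ => rfl
  simp only [mul_apply_eq_comp, smul_apply, h, opX_apply,
    opZ_apply, pair_add_right, sgn_add]
  ring

lemma opX_single (b : Bond) : opX (Finsupp.single b 1) = pauliX b := rfl

lemma opZ_single (b : Bond) : opZ (Finsupp.single b 1) = pauliZ b := by
  ext ψ c
  simp [opZ_apply, pauliZ_apply, sgn]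

lemma star_opX (a : Config) : star (opX a) = opX a := by
  have h : opX a = ((monomial (Equiv.addRight a) (fun _ => 1) (by simp)).symm :
      SpinSpace →L[ℂ] SpinSpace) := by
    ext ψ c
    rw [opX_apply]
    refine Eq.symm ((monomial_symm_apply _ _ _ ψ c).trans ?_)
    simp [neg_eq_of_add_eq_zero_left (config_add_self a)]
  conv_rhs => rw [h]
  exact LinearIsometryEquiv.adjoint_eq_symm _

lemma star_opZ (b : Config) : star (opZ b) = opZ b := by
  have h : opZ b = ((monomial (Equiv.refl Config) (fun c => sgn (pair b c)) (by simp)).symm :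
      SpinSpace →L[ℂ] SpinSpace) := by
    ext ψ c
    rw [opZ_apply]
    refine Eq.symm ((monomial_symm_apply _ _ _ ψ c).trans ?_)
    simp [inv_eq_of_mul_eq_one_left (sgn_mul_self _)]
  conv_rhs => rw [h]
  exact LinearIsometryEquiv.adjoint_eq_symm _

lemma opX_mem (a : Config) : opX a ∈ localAlgebra := by
  induction a using Finsupp.induction_linear with
  | zero => rw [opX_zero]; exact one_mem _
  | add a b ha hb => rw [opX_add]; exact mul_mem ha hb
  | single b z =>
    rcases zmod_two_cases z with rfl | rfl
    · rw [Finsupp.single_zero, opX_zero]; exact one_mem _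
    · exact StarAlgebra.subset_adjoin ℂ _ (Or.inl ⟨b, rfl⟩)

lemma opZ_mem (a : Config) : opZ a ∈ localAlgebra := by
  induction a using Finsupp.induction_linear with
  | zero => rw [opZ_zero]; exact one_mem _
  | add a b ha hb => rw [opZ_add]; exact mul_mem ha hb
  | single b z =>
    rcases zmod_two_cases z with rfl | rfl
    · rw [Finsupp.single_zero, opZ_zero]; exact one_mem _
    · rw [opZ_single]; exact StarAlgebra.subset_adjoin ℂ _ (Or.inr ⟨b, rfl⟩)

/-- The product of `σˣ` over the support of `a`. -/
def X (a : Config) : QuasiLocal := ⟨opX a, localAlgebra.le_topologicalClosure (opX_mem a)⟩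

/-- The product of `σᶻ` over the support of `b`. -/
def Z (b : Config) : QuasiLocal := ⟨opZ b, localAlgebra.le_topologicalClosure (opZ_mem b)⟩

@[simp] lemma X_zero : X 0 = 1 := Subtype.ext opX_zero

@[simp] lemma Z_zero : Z 0 = 1 := Subtype.ext opZ_zero

lemma X_add (a b : Config) : X (a + b) = X a * X b := Subtype.ext (opX_add a b)

lemma Z_add (a b : Config) : Z (a + b) = Z a * Z b := Subtype.ext (opZ_add a b)

lemma X_mul_Z (a b : Config) : X a * Z b = sgn (pair b a) • (Z b * X a) :=
  Subtype.ext (opX_mul_opZ a b)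

lemma Z_mul_X (a b : Config) : Z b * X a = sgn (pair b a) • (X a * Z b) := by
  rw [X_mul_Z, smul_smul, sgn_mul_self, one_smul]

@[simp] lemma star_X (a : Config) : star (X a) = X a := Subtype.ext (star_opX a)

@[simp] lemma star_Z (b : Config) : star (Z b) = Z b := Subtype.ext (star_opZ b)

@[simp] lemma X_mul_self (a : Config) : X a * X a = 1 := by
  rw [← X_add, config_add_self, X_zero]

@[simp] lemma Z_mul_self (a : Config) : Z a * Z a = 1 := by
  rw [← Z_add, config_add_self, Z_zero]

lemma X_single (b : Bond) : X (Finsupp.single b 1) = σx b := rfl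

lemma Z_single (b : Bond) : Z (Finsupp.single b 1) = σz b := Subtype.ext (opZ_single b)

lemma X_mul_comm (a b : Config) : X a * X b = X b * X a := by
  rw [← X_add, ← X_add, add_comm]

lemma Z_mul_comm (a b : Config) : Z a * Z b = Z b * Z a := by
  rw [← Z_add, ← Z_add, add_comm]

lemma prod_map_σx (l : List Bond) :
    (l.map σx).prod = X (l.map fun b => Finsupp.single b 1).sum := by
  induction l with
  | nil => simp
  | cons b l ih => simp [X_add, ih, X_single]

lemma prod_map_σz (l : List Bond) :
    (l.map σz).prod = Z (l.map fun b => Finsupp.single b 1).sum := by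
  induction l with
  | nil => simp
  | cons b l ih => simp [Z_add, ih, Z_single]

/-- The configuration supported by the star of `s`. -/
def starConfig (s : Point) : Config := ((starBonds s).map fun b => Finsupp.single b 1).sum

/-- The configuration supported by the boundary of the plaquette `p`. -/
def plaqConfig (p : Plaquette) : Config := ((plaqBonds p).map fun b => Finsupp.single b 1).sum

lemma starOp_eq (s : Point) : starOp s = X (starConfig s) := prod_map_σx _

lemma plaqOp_eq (p : Plaquette) : plaqOp p = Z (plaqConfig p) := prod_map_σz _

lemma pair_starConfig (s : Point) (f : Config) : pair f (starConfig s) =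
    f (s, .hor) + f (s, .ver) + f (s - e₁, .hor) + f (s - e₂, .ver) := by
  simp [starConfig, starBonds, pair_add_right, add_assoc]

lemma pair_plaqConfig (p : Plaquette) (f : Config) : pair (plaqConfig p) f =
    f (p, .hor) + f (p, .ver) + f (p + e₂, .hor) + f (p + e₁, .ver) := by
  simp [plaqConfig, plaqBonds, pair_add_left, add_assoc]

/-! ### Products of Pauli matrices span a dense subspace -/

/-- Reordering Pauli matrices costs only a sign, so the linear span of the products is already
closed under multiplication and adjoints. -/
lemma mem_span_of_mem_localAlgebra {A : SpinSpace →L[ℂ] SpinSpace} (hA : A ∈ localAlgebra) :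
    A ∈ Submodule.span ℂ (Set.range fun ab : Config × Config => opX ab.1 * opZ ab.2) := by
  induction hA using StarAlgebra.adjoin_induction with
  | mem A h =>
    rcases h with ⟨b, rfl⟩ | ⟨b, rfl⟩
    · exact Submodule.subset_span ⟨(Finsupp.single b 1, 0), by simp [opZ_zero, opX_single]⟩
    · exact Submodule.subset_span ⟨(0, Finsupp.single b 1), by simp [opX_zero, opZ_single]⟩
  | algebraMap r =>
    rw [Algebra.algebraMap_eq_smul_one]
    exact Submodule.smul_mem _ _ (Submodule.subset_span ⟨0, by simp [opX_zero, opZ_zero]⟩)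
  | add A B _ _ hA hB => exact add_mem hA hB
  | mul A B _ _ hA hB =>
    have h := Submodule.mul_mem_mul hA hB
    rw [Submodule.span_mul_span] at h
    refine Submodule.span_le.mpr ?_ h
    rintro _ ⟨_, ⟨⟨a, b⟩, rfl⟩, _, ⟨⟨c, d⟩, rfl⟩, rfl⟩
    have : opX a * opZ b * (opX c * opZ d) =
        sgn (pair b c) • (opX (a + c) * opZ (b + d)) := by
      rw [opX_add, opZ_add, mul_assoc (opX a) (opX c), ← mul_assoc (opX c), opX_mul_opZ c b,
        smul_mul_assoc, mul_smul_comm, smul_smul, sgn_mul_self, one_smul]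
      simp only [mul_assoc]
    simp only [this]
    exact Submodule.smul_mem _ _ (Submodule.subset_span ⟨(a + c, b + d), rfl⟩)
  | star A hloc hA =>
    clear hloc
    induction hA using Submodule.span_induction with
    | mem A h =>
      obtain ⟨⟨a, b⟩, rfl⟩ := h
      have : star (opX a * opZ b) = sgn (pair b a) • (opX a * opZ b) := by
        rw [star_mul, star_opX, star_opZ, opX_mul_opZ, smul_smul, sgn_mul_self, one_smul]
      simp only [this]
      exact Submodule.smul_mem _ _ (Submodule.subset_span ⟨(a, b), rfl⟩)
    | zero => simp
    | add A B _ _ hA hB => rw [star_add]; exact add_mem hA hB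
    | smul r A _ hA => rw [star_smul]; exact Submodule.smul_mem _ _ hA

/-- A closed property of observables that is stable under linear combinations and holds for
products of Pauli matrices holds for all observables. -/
theorem pauli_induction {p : QuasiLocal → Prop} (closed : IsClosed {A | p A})
    (pauli : ∀ a b, p (X a * Z b)) (add : ∀ A B, p A → p B → p (A + B))
    (smul : ∀ (r : ℂ) A, p A → p (r • A)) (A : QuasiLocal) : p A := by
  -- The span lives among all bounded operators but `p` is defined only on the quasi-local ones, so
  -- membership is carried through the induction.
  have hloc : ∀ B ∈ localAlgebra, ∃ h : B ∈ quasiLocal, p ⟨B, h⟩ := by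
    intro B hB
    replace hB := mem_span_of_mem_localAlgebra hB
    induction hB using Submodule.span_induction with
    | mem B h =>
      obtain ⟨⟨a, b⟩, rfl⟩ := h
      exact ⟨_, pauli a b⟩
    | zero => exact ⟨zero_mem _, by
      have h := smul 0 _ (pauli 0 0)
      rwa [zero_smul] at h⟩
    | add B C _ _ hB hC => exact ⟨_, add _ _ hB.2 hC.2⟩
    | smul r B _ hB => exact ⟨_, smul r _ hB.2⟩
  have hd : Dense {B : QuasiLocal | (B : SpinSpace →L[ℂ] SpinSpace) ∈ localAlgebra} := by
    rw [Subtype.dense_iff]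
    intro B hB
    refine closure_mono ?_ (show B ∈ closure (localAlgebra : Set _) from hB)
    exact fun C hC => ⟨⟨C, (hloc C hC).1⟩, hC, rfl⟩
  have : closure {B : QuasiLocal | (B : SpinSpace →L[ℂ] SpinSpace) ∈ localAlgebra} ⊆ {A | p A} :=
    closure_minimal (fun B hB => (hloc B hB).2) closed
  exact this (hd A)

/-! ### The homology of the lattice -/

/-- The group of finite products of plaquettes, i.e. of boundaries. -/
def boundaries : AddSubgroup Config := AddSubgroup.closure (Set.range plaqConfig)

/-- The group of finite products of stars, i.e. of dual boundaries. -/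
def coboundaries : AddSubgroup Config := AddSubgroup.closure (Set.range starConfig)

lemma plaqConfig_mem (p : Plaquette) : plaqConfig p ∈ boundaries :=
  AddSubgroup.subset_closure ⟨p, rfl⟩

lemma plaqConfig_eq (p : Plaquette) : plaqConfig p =
    Finsupp.single (p, .hor) 1 + Finsupp.single (p, .ver) 1 + Finsupp.single (p + e₂, .hor) 1 +
      Finsupp.single (p + e₁, .ver) 1 := by
  simp [plaqConfig, plaqBonds, add_assoc]

lemma starConfig_eq (s : Point) : starConfig s =
    Finsupp.single (s, .hor) 1 + Finsupp.single (s, .ver) 1 + Finsupp.single (s - e₁, .hor) 1 +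
      Finsupp.single (s - e₂, .ver) 1 := by
  simp [starConfig, starBonds, add_assoc]

@[simp] lemma mk_add_e₁ (x y : ℤ) : (x, y) + e₁ = (x + 1, y) := by simp [e₁]
@[simp] lemma mk_add_e₂ (x y : ℤ) : (x, y) + e₂ = (x, y + 1) := by simp [e₂]
@[simp] lemma mk_sub_e₁ (x y : ℤ) : (x, y) - e₁ = (x - 1, y) := by simp [e₁]
@[simp] lemma mk_sub_e₂ (x y : ℤ) : (x, y) - e₂ = (x, y - 1) := by simp [e₂]

lemma zmod_two_add_eq_zero_iff {x y : ZMod 2} : x + y = 0 ↔ x = y := CharTwo.add_eq_zero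

/-- Boundaries and stars have even overlap. -/
lemma pair_plaqConfig_starConfig (p : Plaquette) (s : Point) :
    pair (plaqConfig p) (starConfig s) = 0 := by
  obtain ⟨x, y⟩ := p
  obtain ⟨z, w⟩ := s
  rw [pair_plaqConfig, starConfig_eq]
  simp only [mk_add_e₁, mk_add_e₂, mk_sub_e₁, mk_sub_e₂, Finsupp.add_apply,
    Finsupp.single_apply, Prod.mk.injEq, reduceCtorEq, and_true, and_false, if_false, add_zero,
    zero_add]
  by_cases h1 : z = x <;> by_cases h2 : z = x + 1 <;> by_cases h3 : w = y <;>
    by_cases h4 : w = y + 1 <;> simp [h1, h2, h3, h4, sub_eq_iff_eq_add] <;> first | omega | rfl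

/-- The configurations whose vertical part is supported by one column. -/
def columnConfigs : AddSubgroup Config where
  carrier := {c | ∀ x y, x ≠ 0 → c ((x, y), .ver) = 0}
  zero_mem' := by simp
  add_mem' := by
    intro a b ha hb x y h
    simp [ha x y h, hb x y h]
  neg_mem' := by
    intro a ha x y h
    simp [ha x y h]

lemma single_hor_mem_columnConfigs (p : Point) (z : ZMod 2) :
    Finsupp.single (p, Direction.hor) z ∈ columnConfigs := by
  intro x y _
  simp

/-- Up to horizontal bonds, a plaquette is the sum of two vertical bonds adjacent in a row. Adding
plaquettes thus slides a vertical bond sideways into the column `x = 0`. -/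
lemma single_ver_mem_sup (x y : ℤ) :
    Finsupp.single ((x, y), Direction.ver) 1 ∈ boundaries ⊔ columnConfigs := by
  have hstep : ∀ x, plaqConfig (x, y) - Finsupp.single ((x, y), .hor) 1 -
      Finsupp.single ((x, y + 1), .hor) 1 ∈ boundaries ⊔ columnConfigs := fun x =>
    sub_mem (sub_mem (AddSubgroup.mem_sup_left (plaqConfig_mem _))
      (AddSubgroup.mem_sup_right (single_hor_mem_columnConfigs _ _)))
      (AddSubgroup.mem_sup_right (single_hor_mem_columnConfigs _ _))
  induction x using Int.induction_on with
  | zero =>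
    refine AddSubgroup.mem_sup_right fun x' y' h => ?_
    simp [Ne.symm h]
  | succ n ih =>
    have := sub_mem (hstep n) ih
    rwa [plaqConfig_eq, mk_add_e₁, mk_add_e₂, show ∀ a b c d : Config,
      a + b + c + d - a - c - b = d by intros; abel] at this
  | pred n ih =>
    have := sub_mem (hstep (-n - 1)) ih
    rwa [plaqConfig_eq, mk_add_e₁, mk_add_e₂, sub_add_cancel, show ∀ a b c d : Config,
      a + b + c + d - a - c - d = b by intros; abel] at this

lemma boundaries_sup_columnConfigs : boundaries ⊔ columnConfigs = ⊤ := by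
  refine eq_top_iff.mpr fun c _ => ?_
  induction c using Finsupp.induction_linear with
  | zero => exact zero_mem _
  | add a b ha hb => exact add_mem (ha trivial) (hb trivial)
  | single b z =>
    rcases zmod_two_cases z with rfl | rfl
    · simp
    · obtain ⟨⟨x, y⟩, _ | _⟩ := b
      · exact AddSubgroup.mem_sup_right (single_hor_mem_columnConfigs _ _)
      · exact single_ver_mem_sup x y

lemma exists_apply_eq_zero (c : Config) {g : ℕ → Bond} (hg : Function.Injective g) :
    ∃ n, c (g n) = 0 := by
  have h : (g ⁻¹' (c.support : Set Bond)).Finite := c.support.finite_toSet.preimage hg.injOn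
  obtain ⟨n, hn⟩ := h.exists_notMem
  exact ⟨n, by simpa using hn⟩

lemma apply_zero_eq_zero (c : Config) {g : ℕ → Bond} (hg : Function.Injective g)
    (h : ∀ n, c (g (n + 1)) = c (g n)) : c (g 0) = 0 := by
  obtain ⟨n, hn⟩ := exists_apply_eq_zero c hg
  have : ∀ n, c (g n) = c (g 0) := by
    intro n
    induction n with
    | zero => rfl
    | succ n ih => rw [h, ih]
  rw [← this n, hn]

/-- The available bonds form a comb: the column `x = 0` as spine, the horizontal lines as teeth.
This is a tree, so it carries no nonzero finite cycle. The cycle condition makes the coefficients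
constant along each half-tooth, where finite support forces zero, and then constant along the spine.
-/
lemma eq_zero_of_mem_columnConfigs {c : Config} (hc : c ∈ columnConfigs)
    (hcyc : ∀ s, pair c (starConfig s) = 0) : c = 0 := by
  have hcyc' : ∀ x y, c ((x, y), .hor) + c ((x, y), .ver) + c ((x - 1, y), .hor) +
      c ((x, y - 1), .ver) = 0 := by
    intro x y
    have := hcyc (x, y)
    rwa [pair_starConfig, mk_sub_e₁, mk_sub_e₂] at this
  have hx : ∀ x y, x ≠ 0 → c ((x, y), .hor) = c ((x - 1, y), .hor) := by
    intro x y h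
    have := hcyc' x y
    rwa [hc x y h, hc x (y - 1) h, add_zero, add_zero, zmod_two_add_eq_zero_iff] at this
  have hright : ∀ x y, 0 ≤ x → c ((x, y), .hor) = 0 := by
    intro x y h
    have := apply_zero_eq_zero c (g := fun n : ℕ => ((x + n, y), .hor))
      (fun m n hmn => by simpa using hmn) (fun n => by
        rw [hx _ _ (by omega)]
        congr 3
        push_cast
        ring)
    simpa using this
  have hleft : ∀ x y, x < 0 → c ((x, y), .hor) = 0 := by
    intro x y h
    have := apply_zero_eq_zero c (g := fun n : ℕ => ((x - n, y), .hor))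
      (fun m n hmn => by simpa using hmn) (fun n => by
        rw [hx (x - n) _ (by omega)]
        congr 3
        push_cast
        ring)
    simpa using this
  have hhor : ∀ x y, c ((x, y), .hor) = 0 := fun x y =>
    (le_or_gt 0 x).elim (hright x y) (hleft x y)
  have hver : ∀ y, c ((0, y), .ver) = 0 := by
    intro y
    have := apply_zero_eq_zero c (g := fun n : ℕ => ((0, y + n), .ver))
      (fun m n hmn => by simpa using hmn) (fun n => by
        have h := hcyc' 0 (y + (n + 1 : ℕ))
        rw [hhor, hhor, zero_add, add_zero, zmod_two_add_eq_zero_iff] at h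
        rw [h]
        congr 3
        push_cast
        ring)
    simpa using this
  ext ⟨⟨x, y⟩, _ | _⟩
  · exact hhor x y
  · by_cases h : x = 0
    · subst h
      exact hver y
    · exact hc x y h

lemma pair_starConfig_of_mem_boundaries {b : Config} (hb : b ∈ boundaries) (s : Point) :
    pair b (starConfig s) = 0 := by
  induction hb using AddSubgroup.closure_induction with
  | mem _ h =>
    obtain ⟨p, rfl⟩ := h
    exact pair_plaqConfig_starConfig p s
  | zero => simp
  | add a b _ _ ha hb => rw [pair_add_left, ha, hb, add_zero]
  | neg a _ ha => rwa [neg_eq_of_add_eq_zero_left (config_add_self a)]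

/-- Finite cycles are boundaries. -/
theorem mem_boundaries {c : Config} (hc : ∀ s, pair c (starConfig s) = 0) : c ∈ boundaries := by
  have h : c ∈ boundaries ⊔ columnConfigs := by simp [boundaries_sup_columnConfigs]
  obtain ⟨b, hb, d, hd, rfl⟩ := AddSubgroup.mem_sup.mp h
  have hd0 : d = 0 := eq_zero_of_mem_columnConfigs hd fun s => by
    simpa [pair_add_left, pair_starConfig_of_mem_boundaries hb] using hc s
  simpa [hd0] using hb

/-- The bijection between bonds and bonds of the (reflected) dual lattice. -/
def dualBond : Bond ≃ Bond :=
  (Equiv.neg (ℤ × ℤ)).prodCongr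
    ⟨fun d => match d with | .hor => .ver | .ver => .hor,
     fun d => match d with | .hor => .ver | .ver => .hor,
     fun d => by cases d <;> rfl, fun d => by cases d <;> rfl⟩

@[simp] lemma dualBond_symm_hor (v : ℤ × ℤ) : dualBond.symm (v, .hor) = (-v, .ver) := rfl
@[simp] lemma dualBond_symm_ver (v : ℤ × ℤ) : dualBond.symm (v, .ver) = (-v, .hor) := rfl

/-- Finite dual cycles are dual boundaries. -/
theorem mem_coboundaries {c : Config} (hc : ∀ p, pair (plaqConfig p) c = 0) :
    c ∈ coboundaries := by
  let D : Config ≃+ Config := Finsupp.domCongr dualBond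
  have hD : ∀ b, D c b = c (dualBond.symm b) := fun b => by simp [D]
  -- The reflection sends the bonds of plaquette `-s` to the star of `s`, turning the dual cycle
  -- condition into the cycle condition.
  have h : D c ∈ boundaries := mem_boundaries fun s => by
    have := hc (-s)
    rw [pair_plaqConfig] at this
    rw [pair_starConfig]
    simp only [hD, dualBond_symm_hor, dualBond_symm_ver, neg_sub]
    rw [← this]
    simp only [sub_eq_neg_add]
    ring
  have hmap : boundaries ≤ coboundaries.comap D.symm.toAddMonoidHom := by
    refine (AddSubgroup.closure_le _).mpr ?_
    rintro _ ⟨p, rfl⟩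
    refine AddSubgroup.subset_closure ⟨-p, ?_⟩
    simp only [D, starConfig_eq, plaqConfig_eq, AddEquiv.toAddMonoidHom_eq_coe,
      AddMonoidHom.coe_coe, map_add, Finsupp.domCongr_symm, Finsupp.domCongr_apply,
      Finsupp.equivMapDomain_single, dualBond_symm_hor, dualBond_symm_ver, neg_add,
      sub_eq_add_neg]
    abel
  simpa using hmap h

/-! ### Functionals with given charges -/

/-- The functional `φ` has the charge `η s` at the point `s` and the flux `θ p` at the plaquette
`p`: multiplication by `A_s` and `B_p` changes it by the corresponding signs. -/
structure HasCharges (φ : QuasiLocal → ℂ) (η θ : ℤ × ℤ → ZMod 2) : Prop where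
  mul_X : ∀ s T, φ (T * X (starConfig s)) = sgn (η s) * φ T
  X_mul : ∀ s T, φ (X (starConfig s) * T) = sgn (η s) * φ T
  mul_Z : ∀ p T, φ (T * Z (plaqConfig p)) = sgn (θ p) * φ T
  Z_mul : ∀ p T, φ (Z (plaqConfig p) * T) = sgn (θ p) * φ T

/-- The star operator at `s` anticommutes with `Z b`, yet removing it on the left or on the right
gives the same sign; hence the value equals its own negative. -/
lemma HasCharges.apply_eq_zero_of_X {φ : QuasiLocal →L[ℂ] ℂ} {η θ : ℤ × ℤ → ZMod 2}
    (h : HasCharges φ η θ) {b : Config} {s : Point} (hb : pair b (starConfig s) ≠ 0) (a : Config) :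
    φ (X a * Z b) = 0 := by
  have hb1 : pair b (starConfig s) = 1 := (zmod_two_cases _).resolve_left hb
  have h1 := h.mul_X s (X a * Z b)
  rw [mul_assoc, Z_mul_X, hb1, mul_smul_comm, ← mul_assoc, X_mul_comm a, mul_assoc, map_smul,
    h.X_mul, sgn_one, smul_eq_mul] at h1
  have h2 : sgn (η s) * φ (X a * Z b) = 0 := by linear_combination -h1 / 2
  exact (mul_eq_zero.mp h2).resolve_left (sgn_ne_zero _)

lemma HasCharges.apply_eq_zero_of_Z {φ : QuasiLocal →L[ℂ] ℂ} {η θ : ℤ × ℤ → ZMod 2}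
    (h : HasCharges φ η θ) {a : Config} {p : Plaquette} (ha : pair (plaqConfig p) a ≠ 0)
    (b : Config) : φ (X a * Z b) = 0 := by
  have ha1 : pair (plaqConfig p) a = 1 := (zmod_two_cases _).resolve_left ha
  have h1 := h.Z_mul p (X a * Z b)
  rw [← mul_assoc, Z_mul_X, ha1, smul_mul_assoc, mul_assoc, Z_mul_comm, ← mul_assoc, map_smul,
    h.mul_Z, sgn_one, smul_eq_mul] at h1
  have h2 : sgn (θ p) * φ (X a * Z b) = 0 := by linear_combination -h1 / 2
  exact (mul_eq_zero.mp h2).resolve_left (sgn_ne_zero _)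

/-- The factor `r` is the product of the signs of the plaquettes composing `b`. It depends on the
charges alone, hence is common to `φ` and `ψ`. -/
lemma HasCharges.exists_mul_Z {φ ψ : QuasiLocal →L[ℂ] ℂ} {η θ : ℤ × ℤ → ZMod 2}
    (hφ : HasCharges φ η θ) (hψ : HasCharges ψ η θ) {b : Config} (hb : b ∈ boundaries) :
    ∃ r : ℂ, ∀ T, φ (T * Z b) = r * φ T ∧ ψ (T * Z b) = r * ψ T := by
  induction hb using AddSubgroup.closure_induction with
  | mem _ h =>
    obtain ⟨p, rfl⟩ := h
    exact ⟨_, fun T => ⟨hφ.mul_Z p T, hψ.mul_Z p T⟩⟩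
  | zero => exact ⟨1, by simp⟩
  | add a b _ _ ha hb =>
    obtain ⟨r, hr⟩ := ha
    obtain ⟨t, ht⟩ := hb
    exact ⟨t * r, fun T => by simp only [Z_add, ← mul_assoc, (ht _).1, (ht _).2, (hr T).1,
      (hr T).2, true_and]⟩
  | neg a _ ha => rwa [neg_eq_of_add_eq_zero_left (config_add_self a)]

lemma HasCharges.exists_mul_X {φ ψ : QuasiLocal →L[ℂ] ℂ} {η θ : ℤ × ℤ → ZMod 2}
    (hφ : HasCharges φ η θ) (hψ : HasCharges ψ η θ) {a : Config} (ha : a ∈ coboundaries) :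
    ∃ r : ℂ, ∀ T, φ (T * X a) = r * φ T ∧ ψ (T * X a) = r * ψ T := by
  induction ha using AddSubgroup.closure_induction with
  | mem _ h =>
    obtain ⟨p, rfl⟩ := h
    exact ⟨_, fun T => ⟨hφ.mul_X p T, hψ.mul_X p T⟩⟩
  | zero => exact ⟨1, by simp⟩
  | add a b _ _ ha hb =>
    obtain ⟨r, hr⟩ := ha
    obtain ⟨t, ht⟩ := hb
    exact ⟨t * r, fun T => by simp only [X_add, ← mul_assoc, (ht _).1, (ht _).2, (hr T).1,
      (hr T).2, true_and]⟩
  | neg a _ ha => rwa [neg_eq_of_add_eq_zero_left (config_add_self a)]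

/-- A continuous functional is determined by its charges and its value at `1`. -/
theorem HasCharges.ext {φ ψ : QuasiLocal →L[ℂ] ℂ} {η θ : ℤ × ℤ → ZMod 2}
    (hφ : HasCharges φ η θ) (hψ : HasCharges ψ η θ) (h1 : φ 1 = ψ 1) (A : QuasiLocal) :
    φ A = ψ A := by
  induction A using pauli_induction with
  | closed => exact isClosed_eq φ.continuous ψ.continuous
  | add A B hA hB => rw [map_add, map_add, hA, hB]
  | smul r A hA => rw [map_smul, map_smul, hA]
  | pauli a b =>
    -- Either the Pauli product anticommutes with a star or plaquette, and both values vanish, or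
    -- homology lets it be stripped down to `1`.
    by_cases hb : ∀ s, pair b (starConfig s) = 0
    · by_cases ha : ∀ p, pair (plaqConfig p) a = 0
      · obtain ⟨r, hr⟩ := hφ.exists_mul_Z hψ (mem_boundaries hb)
        obtain ⟨t, ht⟩ := hφ.exists_mul_X hψ (mem_coboundaries ha)
        rw [(hr _).1, (hr _).2, ← one_mul (X a), (ht _).1, (ht _).2, h1]
      · push Not at ha
        obtain ⟨p, hp⟩ := ha
        rw [hφ.apply_eq_zero_of_Z hp, hψ.apply_eq_zero_of_Z hp]
    · push Not at hb
      obtain ⟨s, hs⟩ := hb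
      rw [hφ.apply_eq_zero_of_X hs, hψ.apply_eq_zero_of_X hs]

/-! ### Uniqueness of the ground state -/

/-- For a self-adjoint unitary, `(U - 1)* (U - 1) = 2 - 2U`, whose expectation is zero. -/
lemma norm_toPreGNS_sub_one (ω : QuasiLocal →ₚ[ℂ] ℂ) (h1 : ω 1 = 1) {U : QuasiLocal}
    (hU : star U = U) (hUU : U * U = 1) (hω : ω U = 1) : ‖ω.toPreGNS (U - 1)‖ = 0 := by
  rw [PositiveLinearMap.preGNS_norm_def]
  simp [hU, mul_sub, sub_mul, hUU, hω, h1]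

/-- A state that is `1` at a self-adjoint unitary `U` is not changed by multiplication by `U`. -/
lemma apply_mul_eq_of_apply_eq_one (ω : QuasiLocal →ₚ[ℂ] ℂ) (h1 : ω 1 = 1) {U : QuasiLocal}
    (hU : star U = U) (hUU : U * U = 1) (hω : ω U = 1) (T : QuasiLocal) : ω (T * U) = ω T := by
  -- Cauchy–Schwarz in the GNS inner product: `U - 1` is a null vector, so `ω (T * (U - 1)) = 0`.
  have h := norm_inner_le_norm (𝕜 := ℂ) (ω.toPreGNS (star T)) (ω.toPreGNS (U - 1))
  rw [norm_toPreGNS_sub_one ω h1 hU hUU hω, mul_zero, norm_le_zero_iff, PositiveLinearMap.preGNS_inner_def] at h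
  simpa [mul_sub, sub_eq_zero] using h

lemma mul_apply_eq_of_apply_eq_one (ω : QuasiLocal →ₚ[ℂ] ℂ) (h1 : ω 1 = 1) {U : QuasiLocal}
    (hU : star U = U) (hUU : U * U = 1) (hω : ω U = 1) (T : QuasiLocal) : ω (U * T) = ω T := by
  have h := apply_mul_eq_of_apply_eq_one ω h1 hU hUU hω (star T)
  have h' := congrArg star h
  rw [← map_star, ← map_star, star_mul, star_star, hU] at h'
  exact h'

lemma IsFrustrationFreeGroundState.hasCharges {ω : QuasiLocal →ₚ[ℂ] ℂ}
    (h : IsFrustrationFreeGroundState ω) : HasCharges ω 0 0 where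
  mul_X s T := by
    simpa using apply_mul_eq_of_apply_eq_one ω h.1 (star_X _) (X_mul_self _)
      (starOp_eq s ▸ h.2.1 s) T
  X_mul s T := by
    simpa using mul_apply_eq_of_apply_eq_one ω h.1 (star_X _) (X_mul_self _)
      (starOp_eq s ▸ h.2.1 s) T
  mul_Z s T := by
    simpa using apply_mul_eq_of_apply_eq_one ω h.1 (star_Z _) (Z_mul_self _)
      (plaqOp_eq s ▸ h.2.2 s) T
  Z_mul s T := by
    simpa using mul_apply_eq_of_apply_eq_one ω h.1 (star_Z _) (Z_mul_self _)
      (plaqOp_eq s ▸ h.2.2 s) T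

/-- A positive functional as a continuous functional. -/
def toCLM (ω : QuasiLocal →ₚ[ℂ] ℂ) : QuasiLocal →L[ℂ] ℂ where
  toLinearMap := ω.toLinearMap
  cont := map_continuous ω

theorem IsFrustrationFreeGroundState.unique {ω ω' : QuasiLocal →ₚ[ℂ] ℂ}
    (h : IsFrustrationFreeGroundState ω) (h' : IsFrustrationFreeGroundState ω') : ω = ω' := by
  ext A
  exact HasCharges.ext (φ := toCLM ω) (ψ := toCLM ω') h.hasCharges h'.hasCharges
    (h.1.trans h'.1.symm) A

/-! ### Existence of the ground state -/

/-- The spin configuration "all spins up". -/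
def allUp : SpinSpace := lp.single 2 0 1

/-- The sum of all configurations obtained from "all spins up" by applying stars from the list. -/
def loopSum : List Point → SpinSpace
  | [] => allUp
  | s :: l => loopSum l + opX (starConfig s) (loopSum l)

lemma opZ_allUp (b : Config) : opZ b allUp = allUp := by
  ext c
  rw [opZ_apply]
  by_cases hc : c = 0
  · simp [hc]
  · simp [allUp, lp.single_apply, hc]

/-- Here `loopSum` is the product of the commuting factors `1 + A_t` applied to `allUp`, and `A_s (1
+ A_s) = 1 + A_s`. -/
lemma opX_loopSum {s : Point} {l : List Point} (hs : s ∈ l) :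
    opX (starConfig s) (loopSum l) = loopSum l := by
  induction l with
  | nil => simp at hs
  | cons t l ih =>
    rw [loopSum, map_add]
    have hcomm : ∀ a b ψ, opX a (opX b ψ) = opX (a + b) ψ := fun a b ψ => by
      rw [opX_add, mul_apply_eq_comp]
    rcases List.mem_cons.mp hs with rfl | hs
    · rw [hcomm, config_add_self, opX_zero, one_apply_eq_self, add_comm]
    · rw [hcomm, add_comm (starConfig s), ← hcomm, ih hs]

lemma opZ_loopSum (p : Plaquette) (l : List Point) : opZ (plaqConfig p) (loopSum l) = loopSum l := by
  induction l with
  | nil => exact opZ_allUp _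
  | cons t l ih =>
    have h : opZ (plaqConfig p) * opX (starConfig t) = opX (starConfig t) * opZ (plaqConfig p) := by
      rw [opX_mul_opZ, pair_plaqConfig_starConfig, sgn_zero, one_smul]
    rw [loopSum, map_add, ← mul_apply_eq_comp, h, mul_apply_eq_comp, ih]

/-- Positivity of the amplitudes excludes cancellation, which keeps `loopSum` nonzero and hence
normalisable. -/
lemma loopSum_nonneg (l : List Point) (c : Config) : 0 ≤ loopSum l c := by
  induction l generalizing c with
  | nil =>
    by_cases hc : c = 0
    · simp [loopSum, allUp, hc]
    · simp [loopSum, allUp, lp.single_apply, hc]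
  | cons t l ih =>
    have : loopSum (t :: l) c = loopSum l c + loopSum l (c + starConfig t) := by
      rw [← opX_apply]
      rfl
    rw [this]
    exact add_nonneg (ih _) (ih _)

lemma one_le_loopSum (l : List Point) : 1 ≤ loopSum l 0 := by
  induction l with
  | nil => simp [loopSum, allUp]
  | cons t l ih =>
    have : loopSum (t :: l) 0 = loopSum l 0 + loopSum l (0 + starConfig t) := by
      rw [← opX_apply]
      rfl
    rw [this]
    exact ih.trans (le_add_of_nonneg_right (loopSum_nonneg _ _))

lemma loopSum_ne_zero (l : List Point) : loopSum l ≠ 0 := fun h => by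
  have := (Complex.le_def.mp (one_le_loopSum l)).1
  rw [h] at this
  norm_num at this

/-- The normalised vector proportional to `loopSum`. -/
def loopState (l : List Point) : SpinSpace := ((‖loopSum l‖⁻¹ : ℝ) : ℂ) • loopSum l

lemma norm_loopState (l : List Point) : ‖loopState l‖ = 1 := by
  rw [loopState, norm_smul]
  simp [loopSum_ne_zero l]

/-- The vector state of `loopState`. -/
def loopFunctional (l : List Point) (A : QuasiLocal) : ℂ :=
  inner ℂ (loopState l) ((A : SpinSpace →L[ℂ] SpinSpace) (loopState l))

lemma norm_loopFunctional_le (l : List Point) (A : QuasiLocal) : ‖loopFunctional l A‖ ≤ ‖A‖ := by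
  refine (norm_inner_le_norm _ _).trans ?_
  rw [norm_loopState, one_mul]
  simpa [norm_loopState] using (A : SpinSpace →L[ℂ] SpinSpace).le_opNorm (loopState l)

lemma loopFunctional_eq_one_of_fixed (l : List Point) (A : QuasiLocal)
    (h : (A : SpinSpace →L[ℂ] SpinSpace) (loopSum l) = loopSum l) : loopFunctional l A = 1 := by
  have : (A : SpinSpace →L[ℂ] SpinSpace) (loopState l) = loopState l := by
    rw [loopState, map_smul, h]
  rw [loopFunctional, this, inner_self_eq_norm_sq_to_K, norm_loopState]
  simp

lemma loopFunctional_nonneg (l : List Point) (B : QuasiLocal) :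
    0 ≤ loopFunctional l (star B * B) := by
  have : loopFunctional l (star B * B) =
      inner ℂ ((B : SpinSpace →L[ℂ] SpinSpace) (loopState l))
        ((B : SpinSpace →L[ℂ] SpinSpace) (loopState l)) := by
    rw [← ContinuousLinearMap.adjoint_inner_right]
    rfl
  rw [this, inner_self_eq_norm_sq_to_K, ← RCLike.ofReal_pow]
  exact RCLike.ofReal_nonneg.mpr (sq_nonneg _)

lemma exists_ultrafilter :
    ∃ U : Ultrafilter (Finset Point), (U : Filter (Finset Point)) ≤ atTop :=
  Ultrafilter.exists_le atTop

/-- A frustration-free ground state exists. -/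
theorem exists_groundState : ∃ ω : QuasiLocal →ₚ[ℂ] ℂ, IsFrustrationFreeGroundState ω := by
  obtain ⟨U, hU⟩ := exists_ultrafilter
  -- The values at `A` stay in a fixed compact disc, so they converge along an ultrafilter.
  have hlim : ∀ A, ∃ r, Tendsto (fun S : Finset Point => loopFunctional S.toList A) U (𝓝 r) := by
    intro A
    obtain ⟨r, _, hr⟩ := (isCompact_closedBall (0 : ℂ) ‖A‖).ultrafilter_le_nhds
      (U.map fun S : Finset Point => loopFunctional S.toList A) (by
        rw [le_principal_iff]
        refine Ultrafilter.mem_map.mpr (Filter.univ_mem' fun S => ?_)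
        exact mem_closedBall_zero_iff.mpr (norm_loopFunctional_le S.toList A))
    exact ⟨r, hr⟩
  choose f hf using hlim
  have heq : ∀ {A r}, (∀ᶠ S : Finset Point in atTop, loopFunctional S.toList A = r) → f A = r :=
    fun {A r} h => tendsto_nhds_unique (hf A)
      (tendsto_const_nhds.congr' ((h.filter_mono hU).mono fun _ h => h.symm))
  refine ⟨PositiveLinearMap.mk₀
    { toFun := f
      map_add' := fun A B => tendsto_nhds_unique (hf _) (((hf A).add (hf B)).congr fun S => ?_)
      map_smul' := fun r A => tendsto_nhds_unique (hf _) (((hf A).const_mul r).congr fun S => ?_) }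
    fun A hA => ?_, ?_, fun s => ?_, fun p => ?_⟩
  · exact (inner_add_right (𝕜 := ℂ) _ _ _).symm
  · exact (inner_smul_right (𝕜 := ℂ) _ _ _).symm
  · obtain ⟨B, rfl⟩ := CStarAlgebra.nonneg_iff_eq_star_mul_self.mp hA
    exact ge_of_tendsto (hf _) (Eventually.of_forall fun S => loopFunctional_nonneg _ B)
  · exact heq (Eventually.of_forall fun S => loopFunctional_eq_one_of_fixed _ _ rfl)
  -- Every finite set of points containing `s` gives a vector fixed by the star at `s`.
  · refine heq ((eventually_ge_atTop {s}).mono fun S hS => loopFunctional_eq_one_of_fixed _ _ ?_)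
    rw [starOp_eq]
    exact opX_loopSum (Finset.mem_toList.mpr (Finset.singleton_subset_iff.mp hS))
  · refine heq (Eventually.of_forall fun S => loopFunctional_eq_one_of_fixed _ _ ?_)
    rw [plaqOp_eq]
    exact opZ_loopSum p _

/-! ### Limits of inner automorphisms -/

lemma mul_mem_unitary_of_paulis (a b : Config) : X a * Z b ∈ unitary QuasiLocal := by
  refine mul_mem ?_ ?_ <;> rw [Unitary.mem_iff] <;> simp

/-- Conjugation by a product of Pauli matrices multiplies products of Pauli matrices by signs. -/
lemma pauli_conj_pauli (x z a b : Config) : X x * Z z * (X a * Z b) * star (X x * Z z) =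
    sgn (pair z a + pair b x) • (X a * Z b) := by
  have h : X x * Z z * (X a * Z b) = sgn (pair z a + pair b x) • (X a * Z b * (X x * Z z)) := by
    calc X x * Z z * (X a * Z b) = X x * (Z z * X a) * Z b := by simp only [mul_assoc]
      _ = sgn (pair z a) • (X a * (X x * Z b) * Z z) := by
        rw [Z_mul_X, mul_smul_comm, smul_mul_assoc, ← mul_assoc (X x), X_mul_comm x,
          mul_assoc, mul_assoc, mul_assoc, Z_mul_comm z, mul_assoc]
      _ = _ := by
        rw [X_mul_Z x, mul_smul_comm, smul_mul_assoc, smul_smul, sgn_add]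
        simp only [mul_assoc]
  rw [h, smul_mul_assoc, mul_assoc, Unitary.mul_star_self_of_mem (mul_mem_unitary_of_paulis x z),
    mul_one]

lemma norm_conj_of_mem_unitary {U : QuasiLocal} (hU : U ∈ unitary QuasiLocal) (A : QuasiLocal) :
    ‖U * A * star U‖ = ‖A‖ := by
  rw [CStarRing.norm_mul_mem_unitary _ (Unitary.star_mem hU), CStarRing.norm_mem_unitary_mul _ hU]

/-- Conjugation by unitaries is isometric, so an `ε/3` argument passes the Cauchy property to norm
limits. -/
lemma isClosed_setOf_exists_tendsto_conj {G : ℕ → QuasiLocal} (hG : ∀ n, G n ∈ unitary QuasiLocal) :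
    IsClosed {A | ∃ L, Tendsto (fun n => G n * A * star (G n)) atTop (𝓝 L)} := by
  refine isClosed_of_closure_subset fun A hA => cauchySeq_tendsto_of_complete ?_
  refine Metric.cauchySeq_iff'.mpr fun ε hε => ?_
  obtain ⟨B, ⟨L, hB⟩, hAB⟩ := Metric.mem_closure_iff.mp hA (ε / 3) (by positivity)
  obtain ⟨N, hN⟩ := Metric.cauchySeq_iff'.mp hB.cauchySeq (ε / 3) (by positivity)
  refine ⟨N, fun n hn => ?_⟩
  have hdist : ∀ n, dist (G n * A * star (G n)) (G n * B * star (G n)) < ε / 3 := fun n => by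
    rw [dist_eq_norm, ← sub_mul, ← mul_sub, norm_conj_of_mem_unitary (hG n), ← dist_eq_norm]
    exact hAB
  have h1 := dist_triangle4 (G n * A * star (G n)) (G n * B * star (G n))
    (G N * B * star (G N)) (G N * A * star (G N))
  have h2 := hdist N
  rw [dist_comm] at h2
  linarith [hdist n, hN n hn]

lemma exists_eventually_eq_of_succ {α : Type*} {u : ℕ → α} (h : ∀ᶠ n in atTop, u (n + 1) = u n) :
    ∃ c, ∀ᶠ n in atTop, u n = c := by
  obtain ⟨N, hN⟩ := eventually_atTop.mp h
  refine ⟨u N, eventually_atTop.mpr ⟨N, fun n hn => ?_⟩⟩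
  induction n, hn using Nat.le_induction with
  | base => rfl
  | succ n hn ih => rw [hN n hn, ih]

lemma eventually_pair_eq_zero {z : ℕ → Config} (hz : ∀ b, ∀ᶠ n in atTop, z n b = 0) (a : Config) :
    ∀ᶠ n in atTop, pair a (z n) = 0 := by
  induction a using Finsupp.induction_linear with
  | zero => simp
  | add a b ha hb =>
    filter_upwards [ha, hb] with n ha hb
    rw [pair_add_left, ha, hb, add_zero]
  | single b c =>
    filter_upwards [hz b] with n h
    rw [pair_single_left, h, mul_zero]

/-- The product of the Pauli matrices of the first `n` steps. -/
def stringOp (x z : ℕ → Config) (n : ℕ) : QuasiLocal :=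
  X (∑ i ∈ Finset.range n, x i) * Z (∑ i ∈ Finset.range n, z i)

/-- Late steps miss the finite supports of `a` and `b`, so they no longer change the sign. -/
lemma exists_eventually_stringOp_conj {x z : ℕ → Config} (hx : ∀ b, ∀ᶠ n in atTop, x n b = 0)
    (hz : ∀ b, ∀ᶠ n in atTop, z n b = 0) (a b : Config) :
    ∃ c, ∀ᶠ n in atTop, stringOp x z n * (X a * Z b) * star (stringOp x z n) =
      sgn c • (X a * Z b) := by
  obtain ⟨c, hc⟩ := exists_eventually_eq_of_succ (u := fun n =>
    pair (∑ i ∈ Finset.range n, z i) a + pair b (∑ i ∈ Finset.range n, x i)) (by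
      filter_upwards [eventually_pair_eq_zero hx b, eventually_pair_eq_zero hz a] with n h1 h2
      simp only [Finset.sum_range_succ, pair_add_right, h1, pair_comm _ a, h2, add_zero])
  refine ⟨c, hc.mono fun n hn => ?_⟩
  rw [stringOp, pauli_conj_pauli, hn]

/-- The pointwise limit of the inner automorphisms defined by the string operators exists and is an
automorphism. -/
theorem exists_limit_automorphism {x z : ℕ → Config} (hx : ∀ b, ∀ᶠ n in atTop, x n b = 0)
    (hz : ∀ b, ∀ᶠ n in atTop, z n b = 0) : ∃ ρ : QuasiLocal ≃⋆ₐ[ℂ] QuasiLocal,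
    ∀ A, Tendsto (fun n => stringOp x z n * A * star (stringOp x z n)) atTop (𝓝 (ρ A)) := by
  have hG : ∀ n, stringOp x z n ∈ unitary QuasiLocal := fun n => mul_mem_unitary_of_paulis _ _
  have hsgn : ∀ a b, ∃ c, Tendsto (fun n => stringOp x z n * (X a * Z b) * star (stringOp x z n))
      atTop (𝓝 (sgn c • (X a * Z b))) := fun a b => by
    obtain ⟨c, hc⟩ := exists_eventually_stringOp_conj hx hz a b
    exact ⟨c, tendsto_const_nhds.congr' (hc.mono fun n hn => hn.symm)⟩
  have hex : ∀ A, ∃ L, Tendsto (fun n => stringOp x z n * A * star (stringOp x z n)) atTop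
      (𝓝 L) := by
    intro A
    induction A using pauli_induction with
    | closed => exact isClosed_setOf_exists_tendsto_conj hG
    | pauli a b =>
      obtain ⟨c, hc⟩ := hsgn a b
      exact ⟨_, hc⟩
    | add A B hA hB =>
      obtain ⟨L, hL⟩ := hA
      obtain ⟨M, hM⟩ := hB
      exact ⟨L + M, (hL.add hM).congr fun n => by rw [mul_add, add_mul]⟩
    | smul r A hA =>
      obtain ⟨L, hL⟩ := hA
      exact ⟨r • L, (hL.const_smul r).congr fun n => by rw [mul_smul_comm, smul_mul_assoc]⟩
  choose f hf using hex
  have hadd : ∀ A B, f (A + B) = f A + f B := fun A B =>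
    tendsto_nhds_unique (hf _) (((hf A).add (hf B)).congr fun n => by rw [mul_add, add_mul])
  have hsmul : ∀ (r : ℂ) A, f (r • A) = r • f A := fun r A =>
    tendsto_nhds_unique (hf _) (((hf A).const_smul r).congr fun n => by
      rw [mul_smul_comm, smul_mul_assoc])
  have hmul : ∀ A B, f (A * B) = f A * f B := fun A B =>
    tendsto_nhds_unique (hf _) (((hf A).mul (hf B)).congr fun n => by
      have := Unitary.star_mul_self_of_mem (hG n)
      calc _ = stringOp x z n * A * (star (stringOp x z n) * stringOp x z n) * B *
            star (stringOp x z n) := by simp only [mul_assoc]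
        _ = _ := by rw [this, mul_one]; simp only [mul_assoc])
  have hstar : ∀ A, f (star A) = star (f A) := fun A =>
    tendsto_nhds_unique (hf _) ((hf A).star.congr fun n => by
      simp only [star_mul, star_star, mul_assoc])
  have hnorm : ∀ A, ‖f A‖ = ‖A‖ := fun A =>
    tendsto_nhds_unique (hf A).norm (tendsto_const_nhds.congr fun n =>
      (norm_conj_of_mem_unitary (hG n) A).symm)
  have hcont : Continuous f :=
    (AddMonoidHomClass.isometry_of_norm (AddMonoidHom.mk' f hadd) hnorm).continuous
  -- Surjectivity comes for free: on Pauli products the limit is multiplication by a sign, hence it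
  -- is its own inverse.
  have hinv : ∀ A, f (f A) = A := by
    intro A
    induction A using pauli_induction with
    | closed => exact isClosed_eq (hcont.comp hcont) continuous_id
    | pauli a b =>
      obtain ⟨c, hc⟩ := hsgn a b
      have h := tendsto_nhds_unique (hf _) hc
      rw [h, hsmul, h, smul_smul, sgn_mul_self, one_smul]
    | add A B hA hB => rw [hadd, hadd, hA, hB]
    | smul r A hA => rw [hsmul, hsmul, hA]
  exact ⟨{ toFun := f, invFun := f, left_inv := hinv, right_inv := hinv, map_mul' := hmul,
           map_add' := hadd, map_star' := hstar, map_smul' := hsmul }, hf⟩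

/-! ### The charges created by a string -/

/-- The indicator function of a point, with values in `ℤ/2`. -/
def ind (v s : ℤ × ℤ) : ZMod 2 := if s = v then 1 else 0

lemma ind_of_ne {v s : ℤ × ℤ} (h : s ≠ v) : ind v s = 0 := by simp [ind, h]

/-- The second endpoint of a bond. -/
def farEnd (b : Bond) : Point := match b with
  | (v, .hor) => v + e₁
  | (v, .ver) => v + e₂

/-- The second plaquette at a bond. -/
def farSide (b : Bond) : Plaquette := match b with
  | (v, .hor) => v - e₂
  | (v, .ver) => v - e₁

lemma mem_starBonds_iff (b : Bond) (v : Point) : b ∈ starBonds v ↔ v = b.1 ∨ v = farEnd b := by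
  obtain ⟨w, _ | _⟩ := b <;> simp [starBonds, farEnd, eq_sub_iff_add_eq, eq_comm]

lemma mem_plaqBonds_iff (b : Bond) (p : Plaquette) :
    b ∈ plaqBonds p ↔ p = b.1 ∨ p = farSide b := by
  obtain ⟨w, _ | _⟩ := b <;> simp [plaqBonds, farSide, eq_sub_iff_add_eq, eq_comm]

lemma starConfig_apply (s : Point) (b : Bond) : starConfig s b = ind b.1 s + ind (farEnd b) s := by
  obtain ⟨w, _ | _⟩ := b <;>
    simp [starConfig_eq, farEnd, ind, Finsupp.single_apply, sub_eq_iff_eq_add] <;> congr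

lemma plaqConfig_apply (p : Plaquette) (b : Bond) :
    plaqConfig p b = ind b.1 p + ind (farSide b) p := by
  obtain ⟨w, _ | _⟩ := b <;>
    simp [plaqConfig_eq, farSide, ind, Finsupp.single_apply, eq_sub_iff_add_eq]

lemma Joins.starConfig_apply {b : Bond} {v w : Point} (h : Joins b v w) (s : Point) :
    starConfig s b = ind v s + ind w s := by
  obtain ⟨hne, hv, hw⟩ := h
  rw [mem_starBonds_iff] at hv hw
  rw [ToricCode.starConfig_apply]
  rcases hv with rfl | rfl <;> rcases hw with rfl | rfl
  · exact absurd rfl hne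
  · rfl
  · exact add_comm _ _
  · exact absurd rfl hne

lemma Separates.plaqConfig_apply {b : Bond} {p q : Plaquette} (h : Separates b p q)
    (r : Plaquette) : plaqConfig r b = ind p r + ind q r := by
  obtain ⟨hne, hp, hq⟩ := h
  rw [mem_plaqBonds_iff] at hp hq
  rw [ToricCode.plaqConfig_apply]
  rcases hp with rfl | rfl <;> rcases hq with rfl | rfl
  · exact absurd rfl hne
  · rfl
  · exact add_comm _ _
  · exact absurd rfl hne

lemma finite_setOf_mem_starBonds (b : Bond) : {v | b ∈ starBonds v}.Finite :=
  (Set.toFinite {b.1, farEnd b}).subset fun v hv => by simpa [mem_starBonds_iff] using hv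

lemma finite_setOf_mem_plaqBonds (b : Bond) : {p | b ∈ plaqBonds p}.Finite :=
  (Set.toFinite {b.1, farSide b}).subset fun v hv => by simpa [mem_plaqBonds_iff] using hv

/-- What matters about a string that extends to infinity: the Pauli matrices of each step, and the
positions of the charge `k` and the flux `l` that are moved along. -/
structure StringData where
  x : ℕ → Config
  z : ℕ → Config
  charge : ZMod 2
  flux : ZMod 2
  point : ℕ → Point
  plaquette : ℕ → Plaquette
  eventually_x : ∀ b, ∀ᶠ n in atTop, x n b = 0
  eventually_z : ∀ b, ∀ᶠ n in atTop, z n b = 0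
  -- Step `n` flips the stars at the old and the new position of the charge; if the charge stays
  -- put, the two indicators cancel mod 2.
  pair_z : ∀ n s, pair (z n) (starConfig s) = charge * (ind (point n) s + ind (point (n + 1)) s)
  pair_x : ∀ n p, pair (plaqConfig p) (x n) =
    flux * (ind (plaquette n) p + ind (plaquette (n + 1)) p)
  eventually_point : ∀ s, ∀ᶠ n in atTop, s ≠ point n
  eventually_plaquette : ∀ p, ∀ᶠ n in atTop, p ≠ plaquette n
  start : point 0 ∈ corners (plaquette 0)

lemma sum_telescope (c : ℕ → ZMod 2) (n : ℕ) :
    ∑ i ∈ Finset.range n, (c i + c (i + 1)) = c 0 + c n := by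
  induction n with
  | zero => exact (CharTwo.add_self_eq_zero _).symm
  | succ n ih =>
    rw [Finset.sum_range_succ, ih, add_assoc, ← add_assoc (c n), CharTwo.add_self_eq_zero, zero_add]

lemma pair_sum_left (z : ℕ → Config) (n : ℕ) (a : Config) :
    pair (∑ i ∈ Finset.range n, z i) a = ∑ i ∈ Finset.range n, pair (z i) a := by
  induction n with
  | zero => simp
  | succ n ih => rw [Finset.sum_range_succ, Finset.sum_range_succ, pair_add_left, ih]

/-- The sign counts the flips of this star mod 2. The sum telescopes to the two ends of the finite
string, and the far end eventually leaves `s`. -/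
lemma StringData.tendsto_starConfig (D : StringData) (s : Point) :
    Tendsto (fun n => stringOp D.x D.z n * X (starConfig s) * star (stringOp D.x D.z n)) atTop
      (𝓝 (sgn (D.charge * ind (D.point 0) s) • X (starConfig s))) := by
  refine tendsto_const_nhds.congr' ?_
  filter_upwards [D.eventually_point s] with n hn
  have h := pauli_conj_pauli (∑ i ∈ Finset.range n, D.x i) (∑ i ∈ Finset.range n, D.z i)
    (starConfig s) 0
  rw [Z_zero, mul_one, pair_zero_left, add_zero, pair_sum_left] at h
  rw [stringOp, h]
  simp only [D.pair_z, ← Finset.mul_sum, sum_telescope (fun i => ind (D.point i) s)]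
  rw [ind_of_ne hn, add_zero]

lemma StringData.tendsto_plaqConfig (D : StringData) (p : Plaquette) :
    Tendsto (fun n => stringOp D.x D.z n * Z (plaqConfig p) * star (stringOp D.x D.z n)) atTop
      (𝓝 (sgn (D.flux * ind (D.plaquette 0) p) • Z (plaqConfig p))) := by
  refine tendsto_const_nhds.congr' ?_
  filter_upwards [D.eventually_plaquette p] with n hn
  have h := pauli_conj_pauli (∑ i ∈ Finset.range n, D.x i) (∑ i ∈ Finset.range n, D.z i)
    0 (plaqConfig p)
  rw [X_zero, one_mul, pair_zero_right, zero_add, pair_comm, pair_sum_left] at h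
  rw [stringOp, h]
  simp only [pair_comm _ (plaqConfig p), D.pair_x, ← Finset.mul_sum,
    sum_telescope (fun i => ind (D.plaquette i) p)]
  rw [ind_of_ne hn, add_zero]

/-! ### The three types of strings in a uniform description. -/

lemma prod_map_X (x : ℕ → Config) (n : ℕ) :
    ((List.range n).map fun i => X (x i)).prod = X (∑ i ∈ Finset.range n, x i) := by
  induction n with
  | zero => simp
  | succ n ih => rw [List.prod_range_succ, ih, Finset.sum_range_succ, X_add]

lemma prod_map_Z (x : ℕ → Config) (n : ℕ) :
    ((List.range n).map fun i => Z (x i)).prod = Z (∑ i ∈ Finset.range n, x i) := by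
  induction n with
  | zero => simp
  | succ n ih => rw [List.prod_range_succ, ih, Finset.sum_range_succ, Z_add]

lemma self_mem_corners (p : Plaquette) : p ∈ corners p := by simp [corners]

lemma finite_setOf_corners (s : Point) : {p | s ∈ corners p}.Finite := by
  refine (Set.toFinite {s, s - e₁, s - e₂, s - e₁ - e₂}).subset fun p hp => ?_
  simp only [corners, Set.mem_ofPred_eq, List.mem_cons, List.not_mem_nil, or_false] at hp
  rcases hp with rfl | rfl | rfl | rfl
  · simp
  · simp
  · simp
  · simp [add_sub_right_comm]

lemma finite_corners (p : Plaquette) : {s | s ∈ corners p}.Finite :=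
  List.finite_toSet _

/-- The string of a path on the lattice. -/
def LatticePath.data (γ : LatticePath) : StringData where
  x _ := 0
  z n := Finsupp.single (γ.bond n) 1
  charge := 1
  flux := 0
  point := γ.point
  -- The flux is zero, so its position is arbitrary; reusing the coordinates of the point makes it a
  -- corner of the plaquette.
  plaquette := γ.point
  eventually_x := by simp
  eventually_z b := by
    filter_upwards [γ.toInfinity.eventually (finite_setOf_mem_starBonds b).eventually_cofinite_notMem]
      with n hn
    refine Finsupp.single_eq_of_ne ?_
    rintro rfl
    exact hn (γ.joins n).2.1
  pair_z n s := by simp [(γ.joins n).starConfig_apply]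
  pair_x := by simp
  eventually_point s := (γ.toInfinity.eventually
    (Set.finite_singleton s).eventually_cofinite_notMem).mono fun n hn h => hn h.symm
  eventually_plaquette s := (γ.toInfinity.eventually
    (Set.finite_singleton s).eventually_cofinite_notMem).mono fun n hn h => hn h.symm
  start := self_mem_corners _

/-- The string of a path on the dual lattice. -/
def DualPath.data (γ : DualPath) : StringData where
  x n := Finsupp.single (γ.bond n) 1
  z _ := 0
  charge := 0
  flux := 1
  point := γ.plaquette
  plaquette := γ.plaquette
  eventually_x b := by
    filter_upwards [γ.toInfinity.eventually (finite_setOf_mem_plaqBonds b).eventually_cofinite_notMem]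
      with n hn
    refine Finsupp.single_eq_of_ne ?_
    rintro rfl
    exact hn (γ.separates n).2.1
  eventually_z := by simp
  pair_z := by simp
  pair_x n s := by simp [(γ.separates n).plaqConfig_apply]
  eventually_point s := (γ.toInfinity.eventually
    (Set.finite_singleton s).eventually_cofinite_notMem).mono fun n hn h => hn h.symm
  eventually_plaquette s := (γ.toInfinity.eventually
    (Set.finite_singleton s).eventually_cofinite_notMem).mono fun n hn h => hn h.symm
  start := self_mem_corners _

/-- The pairs leave finite sets, and a given point is a corner of only finitely many plaquettes, so
the points alone leave them too. -/
lemma Ribbon.tendsto_point (γ : Ribbon) : Tendsto γ.point atTop cofinite := by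
  refine le_cofinite_iff_eventually_ne.mpr fun s => eventually_map.mpr ?_
  filter_upwards [γ.toInfinity.eventually (((Set.finite_singleton s).prod
    (finite_setOf_corners s)).eventually_cofinite_notMem)] with n hn h
  exact hn ⟨h, h ▸ γ.combined n⟩

lemma Ribbon.tendsto_plaquette (γ : Ribbon) : Tendsto γ.plaquette atTop cofinite := by
  refine le_cofinite_iff_eventually_ne.mpr fun p => eventually_map.mpr ?_
  filter_upwards [γ.toInfinity.eventually (((finite_corners p).prod
    (Set.finite_singleton p)).eventually_cofinite_notMem)] with n hn h
  exact hn ⟨h ▸ γ.combined n, h⟩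

/-- The string of a ribbon. -/
def Ribbon.data (γ : Ribbon) : StringData where
  x n := if γ.onLattice n then 0 else Finsupp.single (γ.bond n) 1
  z n := if γ.onLattice n then Finsupp.single (γ.bond n) 1 else 0
  charge := 1
  flux := 1
  point := γ.point
  plaquette := γ.plaquette
  eventually_x b := by
    filter_upwards [γ.tendsto_plaquette.eventually
      (finite_setOf_mem_plaqBonds b).eventually_cofinite_notMem] with n hn
    split_ifs with h
    · rfl
    · refine Finsupp.single_eq_of_ne ?_
      rintro rfl
      exact hn (γ.dualStep n (by simpa using h)).1.2.1
  eventually_z b := by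
    filter_upwards [γ.tendsto_point.eventually
      (finite_setOf_mem_starBonds b).eventually_cofinite_notMem] with n hn
    split_ifs with h
    · refine Finsupp.single_eq_of_ne ?_
      rintro rfl
      exact hn (γ.latticeStep n h).1.2.1
    · rfl
  pair_z n s := by
    split_ifs with h
    · simp [(γ.latticeStep n h).1.starConfig_apply]
    · simp [(γ.dualStep n (by simpa using h)).2, CharTwo.add_self_eq_zero]
  pair_x n p := by
    split_ifs with h
    · simp [(γ.latticeStep n h).2, CharTwo.add_self_eq_zero]
    · simp [(γ.dualStep n (by simpa using h)).1.plaqConfig_apply]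
  eventually_point s := (γ.tendsto_point.eventually
    (Set.finite_singleton s).eventually_cofinite_notMem).mono fun n hn h => hn h.symm
  eventually_plaquette s := (γ.tendsto_plaquette.eventually
    (Set.finite_singleton s).eventually_cofinite_notMem).mono fun n hn h => hn h.symm
  start := γ.combined 0

/-- The data of a string of any type. -/
def InfiniteString.data : InfiniteString → StringData
  | .X γ => γ.data
  | .Y γ => γ.data
  | .Z γ => γ.data

lemma InfiniteString.op_eq (γ : InfiniteString) (n : ℕ) :
    γ.op n = stringOp γ.data.x γ.data.z n := by
  rcases γ with γ | γ | γ
  · simp [InfiniteString.op, stringOp, InfiniteString.data, DualPath.data, ← prod_map_X, X_single]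
  · rw [stringOp, ← prod_map_X, ← prod_map_Z]
    simp only [InfiniteString.op, InfiniteString.data, Ribbon.data, apply_ite ToricCode.X,
      apply_ite ToricCode.Z,
      X_zero, Z_zero, X_single, Z_single]
  · simp [InfiniteString.op, stringOp, InfiniteString.data, LatticePath.data, ← prod_map_Z,
      Z_single]

/-- The automorphism defined by a string, with its action on stars and plaquettes. -/
theorem exists_stringAutomorphism (γ : InfiniteString) :
    ∃ ρ : QuasiLocal ≃⋆ₐ[ℂ] QuasiLocal, IsStringAutomorphism γ ρ ∧
      (∀ s, ρ (X (starConfig s)) =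
        sgn (γ.data.charge * ind (γ.data.point 0) s) • X (starConfig s)) ∧
      ∀ p, ρ (Z (plaqConfig p)) =
        sgn (γ.data.flux * ind (γ.data.plaquette 0) p) • Z (plaqConfig p) := by
  obtain ⟨ρ, hρ⟩ := exists_limit_automorphism γ.data.eventually_x γ.data.eventually_z
  refine ⟨ρ, fun A => ?_, fun s => ?_, fun p => ?_⟩
  · simpa only [γ.op_eq] using hρ A
  · exact tendsto_nhds_unique (hρ _) (γ.data.tendsto_starConfig s)
  · exact tendsto_nhds_unique (hρ _) (γ.data.tendsto_plaqConfig p)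

/-! ### Translations of products of Pauli matrices -/

lemma translateOp_add (x y : ℤ × ℤ) (ψ : SpinSpace) :
    translateOp (x + y) ψ = translateOp x (translateOp y ψ) := by
  ext c
  simp only [translateOp, monomial_apply, one_mul]
  refine congrArg (fun c => ψ c) ?_
  ext ⟨v, d⟩
  simp [shiftBond, Finsupp.domCongr, add_comm x, add_assoc]

lemma translateOp_zero (ψ : SpinSpace) : translateOp 0 ψ = ψ := by
  ext c
  simp only [translateOp, monomial_apply, one_mul]
  refine congrArg (fun c => ψ c) ?_
  ext ⟨v, d⟩
  simp [shiftBond, Finsupp.domCongr]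

lemma translateOp_symm (x : ℤ × ℤ) (ψ : SpinSpace) :
    (translateOp x).symm ψ = translateOp (-x) ψ := by
  rw [LinearIsometryEquiv.symm_apply_eq, ← translateOp_add, add_neg_cancel, translateOp_zero]

lemma coe_τ_apply (x : ℤ × ℤ) (A : QuasiLocal) (ψ : SpinSpace) :
    (τ x A : SpinSpace →L[ℂ] SpinSpace) ψ =
      translateOp x ((A : SpinSpace →L[ℂ] SpinSpace) (translateOp (-x) ψ)) := by
  rw [← translateOp_symm]
  exact LinearIsometryEquiv.conjStarAlgEquiv_apply_apply _ _ _

lemma τ_add (x y : ℤ × ℤ) (A : QuasiLocal) : τ (x + y) A = τ x (τ y A) := by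
  refine Subtype.ext (ContinuousLinearMap.ext fun ψ => ?_)
  rw [coe_τ_apply, coe_τ_apply, coe_τ_apply, translateOp_add, neg_add_rev, translateOp_add]

lemma τ_zero (A : QuasiLocal) : τ 0 A = A := by
  refine Subtype.ext (ContinuousLinearMap.ext fun ψ => ?_)
  rw [coe_τ_apply, neg_zero, translateOp_zero, translateOp_zero]

/-- Translation of configurations. -/
def shiftConfig (x : ℤ × ℤ) : Config ≃+ Config := Finsupp.domCongr (shiftBond x)

@[simp] lemma shiftConfig_single (x v : ℤ × ℤ) (d : Direction) (z : ZMod 2) :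
    shiftConfig x (Finsupp.single (v, d) z) = Finsupp.single (v + x, d) z := by
  simp [shiftConfig, shiftBond]

lemma shiftConfig_starConfig (x : ℤ × ℤ) (s : Point) :
    shiftConfig x (starConfig s) = starConfig (s + x) := by
  simp [starConfig_eq, sub_add_eq_add_sub]

lemma shiftConfig_plaqConfig (x : ℤ × ℤ) (p : Plaquette) :
    shiftConfig x (plaqConfig p) = plaqConfig (p + x) := by
  simp [plaqConfig_eq, add_right_comm]

lemma τ_X (x : ℤ × ℤ) (a : Config) : τ x (X a) = X (shiftConfig x a) := by
  induction a using Finsupp.induction_linear with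
  | zero => simp
  | add a b ha hb => rw [X_add, map_mul, ha, hb, map_add, X_add]
  | single b z =>
    rcases zmod_two_cases z with rfl | rfl
    · simp
    · obtain ⟨v, d⟩ := b
      rw [shiftConfig_single, X_single, τ_σx, X_single]
      rfl

lemma τ_Z (x : ℤ × ℤ) (a : Config) : τ x (Z a) = Z (shiftConfig x a) := by
  induction a using Finsupp.induction_linear with
  | zero => simp
  | add a b ha hb => rw [Z_add, map_mul, ha, hb, map_add, Z_add]
  | single b z =>
    rcases zmod_two_cases z with rfl | rfl
    · simp
    · obtain ⟨v, d⟩ := b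
      rw [shiftConfig_single, Z_single, τ_σz, Z_single]
      rfl

/-! ### Implementation of translations -/

section Implementation

variable {H : Type*} [NormedAddCommGroup H] [InnerProductSpace ℂ H] [CompleteSpace H]

/-- The assignment `f A ↦ g A` is well defined and isometric between dense subspaces, so it extends
to a unitary. -/
lemma exists_unitary_of_norm_eq {E : Type*} [AddCommGroup E] [Module ℂ E] {f g : E →ₗ[ℂ] H}
    (hf : DenseRange f) (hg : DenseRange g) (h : ∀ A, ‖g A‖ = ‖f A‖) :
    ∃ V : unitary (H →L[ℂ] H), ∀ A, (V : H →L[ℂ] H) (f A) = g A :=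
  ⟨Unitary.linearIsometryEquiv.symm
    ((LinearEquiv.refl ℂ E).extendOfIsometry f g hf hg h), fun A =>
      LinearEquiv.extendOfIsometry_eq (LinearEquiv.refl ℂ E) f g hf hg h A⟩

/-- The map `A ↦ π(A) Ψ`. -/
def orbit (π : QuasiLocal →⋆ₐ[ℂ] (H →L[ℂ] H)) (Ψ : H) : QuasiLocal →ₗ[ℂ] H where
  toFun A := π A Ψ
  map_add' A B := by simp
  map_smul' r A := by simp

lemma orbit_apply (π : QuasiLocal →⋆ₐ[ℂ] (H →L[ℂ] H)) (Ψ : H) (A : QuasiLocal) :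
    orbit π Ψ A = π A Ψ := rfl

/-- The functional `A ↦ ⟨Ψ, π(A) Ψ⟩`. -/
def vectorFunctional (π : QuasiLocal →⋆ₐ[ℂ] (H →L[ℂ] H)) (Ψ : H) : QuasiLocal →L[ℂ] ℂ where
  toFun A := inner ℂ Ψ (π A Ψ)
  map_add' A B := by simp
  map_smul' r A := by simp
  cont := by
    have : Continuous π := map_continuous π
    exact continuous_const.inner (this.clm_apply continuous_const)

lemma vectorFunctional_apply (π : QuasiLocal →⋆ₐ[ℂ] (H →L[ℂ] H)) (Ψ : H) (A : QuasiLocal) :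
    vectorFunctional π Ψ A = inner ℂ Ψ (π A Ψ) := rfl

lemma inner_orbit (π : QuasiLocal →⋆ₐ[ℂ] (H →L[ℂ] H)) (Ψ : H) (A B : QuasiLocal) :
    inner ℂ (π A Ψ) (π B Ψ) = vectorFunctional π Ψ (star A * B) := by
  rw [vectorFunctional_apply, map_mul, map_star, mul_apply_eq_comp,
    ContinuousLinearMap.star_eq_adjoint, ContinuousLinearMap.adjoint_inner_right]

lemma norm_orbit_eq {π π' : QuasiLocal →⋆ₐ[ℂ] (H →L[ℂ] H)} {Ψ Φ : H}
    (h : ∀ A, vectorFunctional π Ψ A = vectorFunctional π' Φ A) (A : QuasiLocal) :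
    ‖π A Ψ‖ = ‖π' A Φ‖ := by
  have := inner_orbit π Ψ A A
  rw [h, ← inner_orbit, inner_self_eq_norm_sq_to_K, inner_self_eq_norm_sq_to_K] at this
  exact (sq_eq_sq₀ (norm_nonneg _) (norm_nonneg _)).mp (by exact_mod_cast this)

/-- Replacing `A` by `A * star F` recovers the old orbit. -/
lemma denseRange_orbit_of_isUnit {π : QuasiLocal →⋆ₐ[ℂ] (H →L[ℂ] H)} {Ψ : H}
    (h : DenseRange (orbit π Ψ)) {F : QuasiLocal} (hF : F ∈ unitary QuasiLocal) :
    DenseRange (orbit π (π F Ψ)) := by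
  refine h.mono ?_
  rintro _ ⟨A, rfl⟩
  refine ⟨A * star F, ?_⟩
  rw [orbit_apply, orbit_apply, ← mul_apply_eq_comp, ← map_mul, mul_assoc,
    Unitary.star_mul_self_of_mem hF, mul_one]

lemma denseRange_orbit_comp_τ {π : QuasiLocal →⋆ₐ[ℂ] (H →L[ℂ] H)} {Ψ : H}
    (h : DenseRange (orbit π Ψ)) (x : ℤ × ℤ) : DenseRange (orbit (π.comp (τ x)) Ψ) := by
  refine h.mono ?_
  rintro _ ⟨A, rfl⟩
  refine ⟨τ (-x) A, ?_⟩
  rw [orbit_apply, orbit_apply, StarAlgHom.comp_apply, ← τ_add, add_neg_cancel, τ_zero]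

lemma ext_of_dense {π : QuasiLocal →⋆ₐ[ℂ] (H →L[ℂ] H)} {Ψ : H} (h : DenseRange (orbit π Ψ))
    {S T : H →L[ℂ] H} (hST : ∀ A, S (π A Ψ) = T (π A Ψ)) : S = T :=
  DFunLike.coe_injective (h.equalizer S.continuous T.continuous (funext hST))

/-- If `F` transports the vector state of `Ψ` to its translate by `x`, then the translation by `x`
is implemented by a unitary operator that maps `Ψ` to `π(F) Ψ`. -/
lemma exists_implementer {π : QuasiLocal →⋆ₐ[ℂ] (H →L[ℂ] H)} {Ψ : H}
    (hΨ : DenseRange (orbit π Ψ)) {F : QuasiLocal} (hF : F ∈ unitary QuasiLocal) (x : ℤ × ℤ)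
    (h : ∀ A, vectorFunctional (π.comp (τ x)) (π F Ψ) A = vectorFunctional π Ψ A) :
    ∃ V : unitary (H →L[ℂ] H), (∀ A, (V : H →L[ℂ] H) (π A Ψ) = π (τ x A * F) Ψ) ∧
      ∀ A, π (τ x A) = (V : H →L[ℂ] H) * π A * star (V : H →L[ℂ] H) := by
  obtain ⟨V, hV⟩ := exists_unitary_of_norm_eq hΨ
    (denseRange_orbit_comp_τ (denseRange_orbit_of_isUnit hΨ hF) x) (norm_orbit_eq h)
  have hV' : ∀ A, (V : H →L[ℂ] H) (π A Ψ) = π (τ x A * F) Ψ := fun A => by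
    rw [map_mul, mul_apply_eq_comp]
    exact hV A
  refine ⟨V, hV', fun A => ?_⟩
  -- On the orbit, `V π(A) π(B) Ψ = π(τ(AB) F) Ψ = π(τ A) V π(B) Ψ`, and the orbit is dense.
  have hcomm : (V : H →L[ℂ] H) * π A = π (τ x A) * (V : H →L[ℂ] H) := by
    refine ext_of_dense hΨ fun B => ?_
    have h := hV' (A * B)
    rw [map_mul π A, mul_apply_eq_comp, map_mul (τ x), mul_assoc, map_mul π (τ x A),
      mul_apply_eq_comp, ← hV'] at h
    exact h
  rw [hcomm, mul_assoc, Unitary.mul_star_self_of_mem V.2, mul_one]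

/-- If the generators of the translations are implemented by commuting unitary operators, then the
representation is covariant. -/
lemma covariant_of_commute (π : QuasiLocal →⋆ₐ[ℂ] (H →L[ℂ] H)) {V₁ V₂ : unitary (H →L[ℂ] H)}
    (hc : Commute V₁ V₂)
    (h₁ : ∀ A, π (τ e₁ A) = (V₁ : H →L[ℂ] H) * π A * star (V₁ : H →L[ℂ] H))
    (h₂ : ∀ A, π (τ e₂ A) = (V₂ : H →L[ℂ] H) * π A * star (V₂ : H →L[ℂ] H)) :
    ∃ W : Multiplicative (ℤ × ℤ) →* unitary (H →L[ℂ] H), ∀ x A, π (τ x A) =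
      (W (Multiplicative.ofAdd x) : H →L[ℂ] H) * π A *
        star (W (Multiplicative.ofAdd x) : H →L[ℂ] H) := by
  let W : Multiplicative (ℤ × ℤ) →* unitary (H →L[ℂ] H) := MonoidHom.mk'
    (fun x => V₁ ^ x.toAdd.1 * V₂ ^ x.toAdd.2) fun x y => by
      rw [toAdd_mul, Prod.fst_add, Prod.snd_add, zpow_add, zpow_add]
      exact ((hc.zpow_zpow _ _).mul_mul_mul_comm _ _)
  have hW₁ : W (Multiplicative.ofAdd e₁) = V₁ := by simp [W, e₁]
  have hW₂ : W (Multiplicative.ofAdd e₂) = V₂ := by simp [W, e₂]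
  -- The translations implemented by `W` form a subgroup, so the two generators suffice.
  let S : AddSubgroup (ℤ × ℤ) :=
    { carrier := {x | ∀ A, π (τ x A) = (W (Multiplicative.ofAdd x) : H →L[ℂ] H) * π A *
        star (W (Multiplicative.ofAdd x) : H →L[ℂ] H)}
      zero_mem' := fun A => by simp [τ_zero]
      add_mem' := fun {x y} hx hy A => by
        rw [τ_add, hx, hy, ofAdd_add, map_mul, Submonoid.coe_mul, star_mul]
        simp only [mul_assoc]
      neg_mem' := fun {x} hx A => by
        have h := hx (τ (-x) A)
        rw [← τ_add, add_neg_cancel, τ_zero] at h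
        rw [h, ofAdd_neg, map_inv, ← Unitary.star_eq_inv, Unitary.coe_star, star_star]
        simp only [mul_assoc, Unitary.coe_star_mul_self, mul_one]
        rw [← mul_assoc, Unitary.coe_star_mul_self, one_mul] }
  have he₁ : e₁ ∈ S := fun A => by rw [hW₁, h₁]
  have he₂ : e₂ ∈ S := fun A => by rw [hW₂, h₂]
  refine ⟨W, fun x => ?_⟩
  have : x = x.1 • e₁ + x.2 • e₂ := by ext <;> simp [e₁, e₂]
  have hx : x ∈ S := by
    rw [this]
    exact add_mem (zsmul_mem he₁ _) (zsmul_mem he₂ _)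
  exact hx

/-- A representation is covariant if the translates of a cyclic vector can be reached by unitary
observables that satisfy the commutation relation of the translations. -/
lemma covariant_of_transport {π : QuasiLocal →⋆ₐ[ℂ] (H →L[ℂ] H)} {Ψ : H}
    (hΨ : DenseRange (orbit π Ψ)) {F₁ F₂ : QuasiLocal} (hF₁ : F₁ ∈ unitary QuasiLocal)
    (hF₂ : F₂ ∈ unitary QuasiLocal)
    (h₁ : ∀ A, vectorFunctional (π.comp (τ e₁)) (π F₁ Ψ) A = vectorFunctional π Ψ A)
    (h₂ : ∀ A, vectorFunctional (π.comp (τ e₂)) (π F₂ Ψ) A = vectorFunctional π Ψ A)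
    (h : π (τ e₁ F₂ * F₁) Ψ = π (τ e₂ F₁ * F₂) Ψ) :
    ∃ W : Multiplicative (ℤ × ℤ) →* unitary (H →L[ℂ] H), ∀ x A, π (τ x A) =
      (W (Multiplicative.ofAdd x) : H →L[ℂ] H) * π A *
        star (W (Multiplicative.ofAdd x) : H →L[ℂ] H) := by
  obtain ⟨V₁, hV₁, hπ₁⟩ := exists_implementer hΨ hF₁ e₁ h₁
  obtain ⟨V₂, hV₂, hπ₂⟩ := exists_implementer hΨ hF₂ e₂ h₂
  refine covariant_of_commute π (Subtype.ext (ext_of_dense hΨ fun A => ?_)) hπ₁ hπ₂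
  have h₁₂ : (V₁ : H →L[ℂ] H) ((V₂ : H →L[ℂ] H) (π A Ψ)) =
      π (τ (e₁ + e₂) A) (π (τ e₁ F₂ * F₁) Ψ) := by
    rw [hV₂, hV₁, map_mul (τ e₁), ← τ_add, mul_assoc, map_mul π, mul_apply_eq_comp]
  have h₂₁ : (V₂ : H →L[ℂ] H) ((V₁ : H →L[ℂ] H) (π A Ψ)) =
      π (τ (e₁ + e₂) A) (π (τ e₂ F₁ * F₂) Ψ) := by
    rw [hV₁, hV₂, map_mul (τ e₂), ← τ_add, mul_assoc, map_mul π, mul_apply_eq_comp, add_comm e₁]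
  exact (h₁₂.trans (by rw [h])).trans h₂₁.symm

/-! ### Vectors with given charges -/

/-- The vector `Ψ` is an eigenvector of all star and plaquette operators. -/
structure IsCharged (π : QuasiLocal →⋆ₐ[ℂ] (H →L[ℂ] H)) (Ψ : H) (η θ : ℤ × ℤ → ZMod 2) :
    Prop where
  X : ∀ s, π (X (starConfig s)) Ψ = sgn (η s) • Ψ
  Z : ∀ p, π (Z (plaqConfig p)) Ψ = sgn (θ p) • Ψ

lemma IsCharged.hasCharges {π : QuasiLocal →⋆ₐ[ℂ] (H →L[ℂ] H)} {Ψ : H} {η θ : ℤ × ℤ → ZMod 2}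
    (h : IsCharged π Ψ η θ) : HasCharges (vectorFunctional π Ψ) η θ where
  mul_X s T := by
    rw [vectorFunctional_apply, map_mul, mul_apply_eq_comp, h.X, map_smul, inner_smul_right]
    rfl
  X_mul s T := by
    have := inner_orbit π Ψ (ToricCode.X (starConfig s)) T
    rw [star_X] at this
    rw [← this, h.X, inner_smul_left, ← Complex.star_def, star_sgn]
    rfl
  mul_Z s T := by
    rw [vectorFunctional_apply, map_mul, mul_apply_eq_comp, h.Z, map_smul, inner_smul_right]
    rfl
  Z_mul s T := by
    have := inner_orbit π Ψ (ToricCode.Z (plaqConfig s)) T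
    rw [star_Z] at this
    rw [← this, h.Z, inner_smul_left, ← Complex.star_def, star_sgn]
    rfl

lemma mul_pauli_mem_unitary (a b : Config) : Z b * X a ∈ unitary QuasiLocal := by
  refine mul_mem ?_ ?_ <;> rw [Unitary.mem_iff] <;> simp

lemma IsCharged.apply_Z {π : QuasiLocal →⋆ₐ[ℂ] (H →L[ℂ] H)} {Ψ : H} {η θ : ℤ × ℤ → ZMod 2}
    (h : IsCharged π Ψ η θ) (b : Config) :
    IsCharged π (π (ToricCode.Z b) Ψ) (fun s => η s + pair b (starConfig s)) θ where
  X s := by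
    rw [← mul_apply_eq_comp, ← map_mul, X_mul_Z, map_smul, map_mul, smul_apply,
      mul_apply_eq_comp, h.X, map_smul, smul_smul, add_comm, sgn_add]
  Z p := by
    rw [← mul_apply_eq_comp, ← map_mul, Z_mul_comm, map_mul, mul_apply_eq_comp, h.Z, map_smul]

lemma IsCharged.apply_X {π : QuasiLocal →⋆ₐ[ℂ] (H →L[ℂ] H)} {Ψ : H} {η θ : ℤ × ℤ → ZMod 2}
    (h : IsCharged π Ψ η θ) (a : Config) :
    IsCharged π (π (ToricCode.X a) Ψ) η (fun p => θ p + pair (plaqConfig p) a) where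
  X s := by
    rw [← mul_apply_eq_comp, ← map_mul, X_mul_comm, map_mul, mul_apply_eq_comp, h.X, map_smul]
  Z p := by
    rw [← mul_apply_eq_comp, ← map_mul, Z_mul_X, map_smul, map_mul, smul_apply,
      mul_apply_eq_comp, h.Z, map_smul, smul_smul, add_comm, sgn_add]

/-- The coefficient `l` treats strings with and without flux together: the hypothesis says that no
star is applied or that it meets no charge. -/
lemma IsCharged.X_smul {π : QuasiLocal →⋆ₐ[ℂ] (H →L[ℂ] H)} {Ψ : H} {η θ : ℤ × ℤ → ZMod 2}
    (h : IsCharged π Ψ η θ) {s : Point} (l : ZMod 2) (hs : l * η s = 0) :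
    π (ToricCode.X (l • starConfig s)) Ψ = Ψ := by
  rcases zmod_two_cases l with rfl | rfl
  · simp
  · rw [one_smul, h.X, ← one_mul (η s), hs, sgn_zero, one_smul]

lemma IsCharged.Z_smul {π : QuasiLocal →⋆ₐ[ℂ] (H →L[ℂ] H)} {Ψ : H} {η θ : ℤ × ℤ → ZMod 2}
    (h : IsCharged π Ψ η θ) {p : Plaquette} (k : ZMod 2) (hp : k * θ p = 0) :
    π (ToricCode.Z (k • plaqConfig p)) Ψ = Ψ := by
  rcases zmod_two_cases k with rfl | rfl
  · simp
  · rw [one_smul, h.Z, ← one_mul (θ p), hp, sgn_zero, one_smul]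

/-- Seen through `π ∘ τ x`, charges at the translated positions appear at the original ones. -/
lemma IsCharged.comp_τ {π : QuasiLocal →⋆ₐ[ℂ] (H →L[ℂ] H)} {Ψ : H} {k l : ZMod 2}
    {v q x : ℤ × ℤ} (h : IsCharged π Ψ (fun s => k * ind (v + x) s) (fun p => l * ind (q + x) p)) :
    IsCharged (π.comp (τ x)) Ψ (fun s => k * ind v s) (fun p => l * ind q p) where
  X s := by
    rw [StarAlgHom.comp_apply, τ_X, shiftConfig_starConfig, h.X]
    simp [ind]
  Z p := by
    rw [StarAlgHom.comp_apply, τ_Z, shiftConfig_plaqConfig, h.Z]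
    simp [ind]

/-- The translate by `x` of the vector state of a vector with charge `k` at `v` and flux `l` at `q`
is reached by moving the charge along the bond `b` and the flux across the bond `c`. -/
lemma IsCharged.vectorFunctional_transport {π : QuasiLocal →⋆ₐ[ℂ] (H →L[ℂ] H)} {Ψ : H}
    {k l : ZMod 2} {v q x : ℤ × ℤ}
    (h : IsCharged π Ψ (fun s => k * ind v s) (fun p => l * ind q p)) {b c : Bond}
    (hb : ∀ s, starConfig s b = ind v s + ind (v + x) s)
    (hc : ∀ p, plaqConfig p c = ind q p + ind (q + x) p) (A : QuasiLocal) :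
    vectorFunctional (π.comp (τ x)) (π (ToricCode.Z (Finsupp.single b k) *
      ToricCode.X (Finsupp.single c l)) Ψ) A = vectorFunctional π Ψ A := by
  have h' : IsCharged π (π (ToricCode.Z (Finsupp.single b k) *
      ToricCode.X (Finsupp.single c l)) Ψ) (fun s => k * ind (v + x) s)
      (fun p => l * ind (q + x) p) := by
    rw [map_mul, mul_apply_eq_comp]
    convert (h.apply_X (Finsupp.single c l)).apply_Z (Finsupp.single b k) using 2 with s p
    · rw [pair_single_left, hb, ← mul_add, ← add_assoc, CharTwo.add_self_eq_zero, zero_add]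
    · rw [pair_single_right, hc, ← mul_add, ← add_assoc, CharTwo.add_self_eq_zero, zero_add]
  -- Transport followed by pulling back along `τ x` restores the original charges, so rigidity
  -- leaves only the norms of the two vectors to compare.
  refine HasCharges.ext h'.comp_τ.hasCharges h.hasCharges ?_ A
  rw [vectorFunctional_apply, map_one, one_apply_eq_self, inner_orbit,
    Unitary.star_mul_self_of_mem (mul_pauli_mem_unitary _ _)]

/-! ### Commutation of the two unit transports. -/

lemma config_sum_eq (a b c d : Config) : a + b = c + d + (b + d + c + a) := by
  rw [show c + d + (b + d + c + a) = a + b + ((c + d) + (c + d)) by abel, config_add_self,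
    add_zero]

/-- The two ways of moving a charge along the diagonal of a plaquette differ by the plaquette. -/
lemma single_add_single_plaq (v : Point) (k : ZMod 2) :
    (Finsupp.single (v + e₁, .ver) k + Finsupp.single (v, .hor) k : Config) =
      Finsupp.single (v + e₂, .hor) k + Finsupp.single (v, .ver) k + k • plaqConfig v := by
  simp only [plaqConfig_eq, smul_add, Finsupp.smul_single, smul_eq_mul, mul_one]
  exact config_sum_eq _ _ _ _

/-- The two ways of moving a flux diagonally around a point differ by the star of the point. -/
lemma single_add_single_star (q : Plaquette) (l : ZMod 2) :
    (Finsupp.single (q + e₂ + e₁, .hor) l + Finsupp.single (q + e₁, .ver) l : Config) =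
      Finsupp.single (q + e₁ + e₂, .ver) l + Finsupp.single (q + e₂, .hor) l +
        l • starConfig (q + e₁ + e₂) := by
  have h₁ : q + e₁ + e₂ - e₁ = q + e₂ := by abel
  have h₂ : q + e₁ + e₂ - e₂ = q + e₁ := by abel
  rw [starConfig_eq, h₁, h₂, add_right_comm q e₂ e₁]
  simp only [smul_add, Finsupp.smul_single, smul_eq_mul, mul_one]
  generalize (Finsupp.single (q + e₁ + e₂, Direction.hor) l : Config) = a
  generalize (Finsupp.single (q + e₁, Direction.ver) l : Config) = b
  generalize (Finsupp.single (q + e₁ + e₂, Direction.ver) l : Config) = c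
  generalize (Finsupp.single (q + e₂, Direction.hor) l : Config) = d
  rw [config_sum_eq a b c d]
  abel

lemma pauli_mul_pauli {a b c d : Config} (h : pair c b = 0) :
    Z a * X b * (Z c * X d) = Z (a + c) * X (b + d) := by
  rw [mul_assoc, ← mul_assoc (X b), X_mul_Z, h, sgn_zero, one_smul, Z_add, X_add]
  simp only [mul_assoc]

/-- Both sides move the charge from `v` and the flux from `q` diagonally, by different routes. The
routes differ by the plaquette `v` and the star at `q + e₁ + e₂`. When `v` avoids this point, the
strings do not cross with a sign, the star meets no charge and the plaquette meets no flux. -/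
lemma IsCharged.transport_comm {π : QuasiLocal →⋆ₐ[ℂ] (H →L[ℂ] H)} {Ψ : H} {k l : ZMod 2}
    {v q : ℤ × ℤ} (h : IsCharged π Ψ (fun s => k * ind v s) (fun p => l * ind q p))
    (hvq : v ≠ q + e₁ + e₂) :
    π (τ e₁ (ToricCode.Z (Finsupp.single (v, .ver) k) *
        ToricCode.X (Finsupp.single (q + e₂, .hor) l)) *
      (ToricCode.Z (Finsupp.single (v, .hor) k) *
        ToricCode.X (Finsupp.single (q + e₁, .ver) l))) Ψ =
    π (τ e₂ (ToricCode.Z (Finsupp.single (v, .hor) k) *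
        ToricCode.X (Finsupp.single (q + e₁, .ver) l)) *
      (ToricCode.Z (Finsupp.single (v, .ver) k) *
        ToricCode.X (Finsupp.single (q + e₂, .hor) l))) Ψ := by
  have hvq' : v ≠ q + e₂ + e₁ := by rwa [add_right_comm]
  rw [map_mul (τ e₁), map_mul (τ e₂), τ_X, τ_X, τ_Z, τ_Z]
  simp only [shiftConfig_single]
  rw [pauli_mul_pauli (by simp [hvq'.symm]), pauli_mul_pauli (by simp [hvq.symm]),
    single_add_single_plaq, single_add_single_star]
  have hv0 : l * (k * ind v (q + e₁ + e₂)) = 0 := by rw [ind_of_ne hvq.symm, mul_zero, mul_zero]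
  rw [Z_add, X_add, mul_assoc, map_mul, map_mul, map_mul, map_mul]
  simp only [mul_apply_eq_comp]
  rw [h.X_smul l hv0, (h.apply_X _).Z_smul k]
  -- The remaining `X` string carries the flux from `q` through `q + e₂` to `q + e₁ + e₂`. The
  -- indicators at `q` and `q + e₂` cancel mod 2, and the end is not `v`.
  rw [pair_add_right, pair_single_right, pair_single_right, ToricCode.plaqConfig_apply,
    ToricCode.plaqConfig_apply]
  simp only [farSide, add_sub_cancel_right, add_right_comm q e₁ e₂]
  rw [ind_of_ne hvq']
  have hcancel : ∀ k l a b : ZMod 2, k * (l * a + (l * (0 + b) + l * (b + a))) = 0 := by decide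
  exact hcancel _ _ _ _

/-- A representation with a cyclic vector that has a charge at `v` and a flux at `q` is
covariant. -/
theorem IsCharged.covariant {π : QuasiLocal →⋆ₐ[ℂ] (H →L[ℂ] H)} {Ψ : H} {k l : ZMod 2}
    {v q : ℤ × ℤ} (h : IsCharged π Ψ (fun s => k * ind v s) (fun p => l * ind q p))
    (hΨ : DenseRange (orbit π Ψ)) (hvq : v ≠ q + e₁ + e₂) :
    ∃ W : Multiplicative (ℤ × ℤ) →* unitary (H →L[ℂ] H), ∀ x A, π (τ x A) =
      (W (Multiplicative.ofAdd x) : H →L[ℂ] H) * π A *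
        star (W (Multiplicative.ofAdd x) : H →L[ℂ] H) := by
  refine covariant_of_transport hΨ
    -- The charge moves along the bond leaving `v` in the given direction; the flux crosses the
    -- perpendicular bond shared with the next plaquette.
    (F₁ := ToricCode.Z (Finsupp.single (v, .hor) k) * ToricCode.X (Finsupp.single (q + e₁, .ver) l))
    (F₂ := ToricCode.Z (Finsupp.single (v, .ver) k) * ToricCode.X (Finsupp.single (q + e₂, .hor) l))
    (mul_pauli_mem_unitary _ _) (mul_pauli_mem_unitary _ _)
    (h.vectorFunctional_transport (fun s => ?_) fun p => ?_)
    (h.vectorFunctional_transport (fun s => ?_) fun p => ?_) (h.transport_comm hvq)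
  · exact ToricCode.starConfig_apply _ _
  · rw [ToricCode.plaqConfig_apply, farSide, add_sub_cancel_right, add_comm]
  · exact ToricCode.starConfig_apply _ _
  · rw [ToricCode.plaqConfig_apply, farSide, add_sub_cancel_right, add_comm]

end Implementation

/-! ### The GNS representation of the ground state -/

/-- The GNS representation, composed with an automorphism. -/
def gnsComp (ω : QuasiLocal →ₚ[ℂ] ℂ) (ρ : QuasiLocal ≃⋆ₐ[ℂ] QuasiLocal) :
    QuasiLocal →⋆ₐ[ℂ] (ω.GNS →L[ℂ] ω.GNS) :=
  ω.gnsStarAlgHom.comp (StarAlgHomClass.toStarAlgHom ρ)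

lemma gnsComp_apply (ω : QuasiLocal →ₚ[ℂ] ℂ) (ρ : QuasiLocal ≃⋆ₐ[ℂ] QuasiLocal) (A : QuasiLocal) :
    gnsComp ω ρ A = ω.gnsStarAlgHom (ρ A) := rfl

/-- The cyclic vector of the GNS representation. -/
def gnsVector (ω : QuasiLocal →ₚ[ℂ] ℂ) : ω.GNS := (ω.toPreGNS 1 : ω.PreGNS)

lemma gnsStarAlgHom_gnsVector (ω : QuasiLocal →ₚ[ℂ] ℂ) (A : QuasiLocal) :
    ω.gnsStarAlgHom A (gnsVector ω) = (ω.toPreGNS A : ω.PreGNS) := by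
  refine (PositiveLinearMap.gnsNonUnitalStarAlgHom_apply_coe ω).trans ?_
  simp

lemma gnsStarAlgHom_gnsVector_of_apply_eq_one (ω : QuasiLocal →ₚ[ℂ] ℂ) (h1 : ω 1 = 1)
    {U : QuasiLocal} (hU : star U = U) (hUU : U * U = 1) (hω : ω U = 1) :
    ω.gnsStarAlgHom U (gnsVector ω) = gnsVector ω := by
  rw [← sub_eq_zero, ← norm_eq_zero, gnsStarAlgHom_gnsVector, gnsVector,
    ← UniformSpace.Completion.coe_sub, UniformSpace.Completion.norm_coe, ← map_sub]
  exact norm_toPreGNS_sub_one ω h1 hU hUU hω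

/-- Since `ρ` is onto, composing with it does not change the orbit of the GNS vector. -/
lemma denseRange_orbit_gnsVector (ω : QuasiLocal →ₚ[ℂ] ℂ) (ρ : QuasiLocal ≃⋆ₐ[ℂ] QuasiLocal) :
    DenseRange (orbit (gnsComp ω ρ) (gnsVector ω)) := by
  refine (UniformSpace.Completion.denseRange_coe (α := ω.PreGNS)).mono ?_
  rintro _ ⟨A, rfl⟩
  refine ⟨ρ.symm (ω.ofPreGNS A), ?_⟩
  rw [orbit_apply, gnsComp_apply, StarAlgEquiv.apply_symm_apply, gnsStarAlgHom_gnsVector]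
  rfl

lemma IsFrustrationFreeGroundState.isCharged {ω : QuasiLocal →ₚ[ℂ] ℂ}
    (h : IsFrustrationFreeGroundState ω) {ρ : QuasiLocal ≃⋆ₐ[ℂ] QuasiLocal} {η θ : ℤ × ℤ → ZMod 2}
    (hη : ∀ s, ρ (X (starConfig s)) = sgn (η s) • X (starConfig s))
    (hθ : ∀ p, ρ (Z (plaqConfig p)) = sgn (θ p) • Z (plaqConfig p)) :
    IsCharged (gnsComp ω ρ) (gnsVector ω) η θ where
  X s := by
    rw [gnsComp_apply, hη, map_smul, smul_apply, gnsStarAlgHom_gnsVector_of_apply_eq_one ω h.1 (star_X _)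
      (X_mul_self _) (starOp_eq s ▸ h.2.1 s)]
  Z p := by
    rw [gnsComp_apply, hθ, map_smul, smul_apply, gnsStarAlgHom_gnsVector_of_apply_eq_one ω h.1 (star_Z _)
      (Z_mul_self _) (plaqOp_eq p ▸ h.2.2 p)]

/-- A ribbon may start at the upper right corner `q + e₁ + e₂`. Shifting the charge one step left
puts its first coordinate at most at that of `q`. -/
lemma sub_e₁_ne_of_mem_corners {v q : ℤ × ℤ} (h : v ∈ corners q) : v - e₁ ≠ q + e₁ + e₂ := by
  obtain ⟨a, b⟩ := v
  obtain ⟨c, d⟩ := q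
  simp [corners] at h ⊢
  omega

/-- The GNS representation, composed with an automorphism that creates a charge and a flux at a
combined site, is covariant. -/
theorem IsFrustrationFreeGroundState.covariant {ω : QuasiLocal →ₚ[ℂ] ℂ}
    (hω : IsFrustrationFreeGroundState ω) {ρ : QuasiLocal ≃⋆ₐ[ℂ] QuasiLocal} {k l : ZMod 2}
    {v q : ℤ × ℤ} (hX : ∀ s, ρ (X (starConfig s)) = sgn (k * ind v s) • X (starConfig s))
    (hZ : ∀ p, ρ (Z (plaqConfig p)) = sgn (l * ind q p) • Z (plaqConfig p))
    (hvq : v ∈ corners q) :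
    ∃ W : Multiplicative (ℤ × ℤ) →* unitary (ω.GNS →L[ℂ] ω.GNS), ∀ x A, ω.gnsStarAlgHom (ρ (τ x A)) =
      (W (Multiplicative.ofAdd x) : ω.GNS →L[ℂ] ω.GNS) * ω.gnsStarAlgHom (ρ A) *
        star (W (Multiplicative.ofAdd x) : ω.GNS →L[ℂ] ω.GNS) := by
  -- Covariance concerns the representation, not the vector, so another cyclic vector may be used:
  -- here the charge is moved from `v` to `v - e₁`, away from `q + e₁ + e₂`.
  have h := (hω.isCharged hX hZ).apply_Z (Finsupp.single (v - e₁, .hor) k)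
  have hG : Z (Finsupp.single (v - e₁, .hor) k) ∈ unitary QuasiLocal := by
    rw [Unitary.mem_iff]
    simp
  have heq : ∀ s, k * ind v s + pair (Finsupp.single (v - e₁, .hor) k) (starConfig s) =
      k * ind (v - e₁) s := fun s => by
    rw [pair_single_left, starConfig_apply, farEnd, sub_add_cancel, ← mul_add, add_comm, add_assoc,
      CharTwo.add_self_eq_zero, add_zero]
  simp only [heq] at h
  simp only [← gnsComp_apply]
  exact h.covariant (denseRange_orbit_of_isUnit (denseRange_orbit_gnsVector ω ρ) hG)
    (sub_e₁_ne_of_mem_corners hvq)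

end ToricCode

end

/-! ### The main theorem. -/

theorem mainTheorem12 :
    (∃! ω : ToricCode.QuasiLocal →ₚ[ℂ] ℂ, ToricCode.IsFrustrationFreeGroundState ω) ∧
    ∀ ω₀ : ToricCode.QuasiLocal →ₚ[ℂ] ℂ, ToricCode.IsFrustrationFreeGroundState ω₀ →
      ∀ γ : ToricCode.InfiniteString,
        ∃ ρ : ToricCode.QuasiLocal ≃⋆ₐ[ℂ] ToricCode.QuasiLocal,
          ToricCode.IsStringAutomorphism γ ρ ∧
          ∃ W : Multiplicative (ℤ × ℤ) →* unitary (ω₀.GNS →L[ℂ] ω₀.GNS),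
            ∀ (x : ℤ × ℤ) (A : ToricCode.QuasiLocal),
              ω₀.gnsStarAlgHom (ρ (ToricCode.τ x A)) =
                (W (Multiplicative.ofAdd x) : ω₀.GNS →L[ℂ] ω₀.GNS) *
                  ω₀.gnsStarAlgHom (ρ A) *
                  star (W (Multiplicative.ofAdd x) : ω₀.GNS →L[ℂ] ω₀.GNS) := by
  refine ⟨?_, fun ω₀ hω γ => ?_⟩
  · obtain ⟨ω, hω⟩ := ToricCode.exists_groundState
    exact ⟨ω, hω, fun ω' hω' => hω'.unique hω⟩
  · have h := ToricCode.exists_stringAutomorphism γ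
    refine h.elim fun ρ hρ => ⟨ρ, hρ.1, ?_⟩
    exact hω.covariant hρ.2.1 hρ.2.2 γ.data.start
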